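/- **Setting.** Let $d,k\ge 1$ be integers and let $\gamma=(\gamma_1,\dots,\gamma_{d+1})\in\mathbb{R}^{d+1}$ with $\gamma_j>-1$ for all $j$ and $\gamma_j+\cdots+\gamma_{d+1}+d+1-j\neq 0$ for $j=1,\dots,d$. Put $|\gamma|=\gamma_1+\cdots+\gamma_{d+1}$, $\alpha=\gamma_2+\cdots+\gamma_{d+1}+d-1$, $\beta=\gamma_1$, and $\lambda_n^{\xi}=-n(n+\xi)$; note that $\alpha+\beta+1=|\gamma|+d$. For $n\in\mathbb{N}_0$ let $$p_n^{a,b}(t)=(-1)^n\frac{(a+b+1)_n}{n!}\frac{(b+1)_n}{(a+1)_n}\,{}_2F_1\left(\begin{matrix}-n,\;n+a+b+1\\ b+1\end{matrix};t\right)$$ be the Jacobi polynomials on $[0,1]$, and put $p_n^{a,b}=0$ for $n<0$. Write $\mathrm{Wr}_n(F^{(1)}_n,\dots,F^{(r)}_n)=\det\big(F^{(i)}_{n-j+1}\big)_{1\le i,j\le r}$. Let $\psi=(\psi^{(0)},\dots,\psi^{(k-1)})$ be functions of $n\in\mathbb{Z}$, each of the form $(-1)^n$ times a real polynomial in $\lambda_n^{\alpha+\beta+1}$,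 such that $$\tau_n=\mathrm{Wr}_n\big((-1)^n\psi_n^{(0)},\dots,(-1)^n\psi_n^{(k-1)}\big)\neq 0\quad\text{ for all integers } n\ge -1 .$$ *One variable.* For $n,s\in\mathbb{N}_0$ define $$q_n(t)=\mathrm{Wr}_n\big(\psi_n^{(0)},\dots,\psi_n^{(k-1)},p_n^{\alpha,\beta}(t)\big),\qquad \hat q_{n,s}(t)=\mathrm{Wr}_n\big(\psi_{n+s}^{(0)},\dots,\psi_{n+s}^{(k-1)},p_n^{\alpha+2s,\beta}(t)\big).$$ Let $\mathfrak{D}_\alpha=\mathbb{R}\langle\mathcal{D}_1,\mathcal{D}_2\rangle$ be the associative algebra generated by the differential operators $\mathcal{D}_1=(t-1)\partial_t$ and $\mathcal{D}_2=(1-t)\partial_t^2-(\alpha+1)\partial_t$, and let $\mathfrak{A}^{\alpha,\beta;\psi}$ be the algebra of all $f\in\mathbb{R}[t]$ such that $f(\lambda^{\alpha+\beta+1}_{n-k/2})-f(\lambda^{\alpha+\beta+1}_{n-k/2-1})$ is divisible by $\tau_{n-1}$ in $\mathbb{R}[n]$. *Several variables.* Let $z_1=x_1$ and $z_j=x_j/(1-x_1)$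 for $2\le j\le d$. The Jacobi polynomials on the simplex are defined recursively for $\eta\in\mathbb{N}_0^d$ by $$P_\eta^\gamma(x)=p_{\eta_1}^{a_1,\gamma_1}(z_1)\,(1-z_1)^{\eta_2+\cdots+\eta_d}\,P_{\eta_2,\dots,\eta_d}^{\gamma_2,\dots,\gamma_{d+1}}(z_2,\dots,z_d),\qquad a_1=2(\eta_2+\cdots+\eta_d)+\gamma_2+\cdots+\gamma_{d+1}+d-1,$$ with the empty polynomial ($d=0$) equal to $1$. Put, with $s=\eta_2+\cdots+\eta_d$, $$Q_\eta^\gamma(x)=\hat q_{\eta_1,s}(z_1)\,(1-z_1)^{s}\,P_{\eta_2,\dots,\eta_d}^{\gamma_2,\dots,\gamma_{d+1}}(z_2,\dots,z_d).$$ Let $\hat{\mathfrak{D}}_\gamma=\mathbb{R}\langle\hat D_1,\hat D_2\rangle$ be the associative algebra generated by $$\hat D_1=(x_1-1)\partial_{x_1}+\sum_{j=2}^d x_j\partial_{x_j},$$ $$\hat D_2=(1-x_1)\partial_{x_1}^2+\sum_{j=2}^d x_j\partial_{x_j}^2-2\sum_{j=2}^d x_j\partial_{x_j}\partial_{x_1}-(\gamma_2+\cdots+\gamma_{d+1}+d)\,\partial_{x_1}+\sum_{j=2}^d(\gamma_j+1)\partial_{x_j}.$$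 **Theorem.** The polynomials $\{Q_\eta^\gamma(x):\eta\in\mathbb{N}_0^d\}$ form a basis of $\mathbb{R}[x_1,\dots,x_d]$. Furthermore, there is an algebra isomorphism $\Phi:\mathfrak{D}_\alpha\to\hat{\mathfrak{D}}_\gamma$ with $\Phi(\mathcal{D}_1)=\hat D_1$ and $\Phi(\mathcal{D}_2)=\hat D_2$, and for every $f\in\mathfrak{A}^{\alpha,\beta;\psi}$ there is a unique operator $\mathcal{B}_f=\mathcal{B}_f(\mathcal{D}_1,\mathcal{D}_2)\in\mathfrak{D}_\alpha$ with $$\mathcal{B}_f[q_n(t)]=f\big(\lambda^{\alpha+\beta+1}_{n-k/2}\big)\,q_n(t)\quad\text{ for all } n\in\mathbb{N}_0;$$ its image $\mathcal{B}_f(\hat D_1,\hat D_2)=\Phi(\mathcal{B}_f)$ satisfies $$\mathcal{B}_f(\hat D_1,\hat D_2)\,[Q_\eta^\gamma(x)]=f\big(\lambda^{|\gamma|+d}_{|\eta|-k/2}\big)\,Q_\eta^\gamma(x)\quad\text{ for all }\eta\in\mathbb{N}_0^d,$$ where $|\eta|=\eta_1+\cdots+\eta_d$; in particular the eigenvalue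 depends only on the total degree $|\eta|$. -/

import Mathlib

open Polynomial

noncomputable section

namespace AppellLauricella

/-- The quantity `λ_n^ξ = -n (n + ξ)`, for a real index `n`. -/
def lam (ξ n : ℝ) : ℝ := -n * (n + ξ)

/-- The Pochhammer symbol `(x)_i = x (x + 1) ⋯ (x + i - 1)`. -/
def poch (x : ℝ) (i : ℕ) : ℝ := (ascPochhammer ℝ i).eval x

/-- The normalized Jacobi polynomial on `[0, 1]`,
`(-1)^n (α+β+1)_n / n! * (β+1)_n / (α+1)_n * ₂F₁(-n, n+α+β+1; β+1; t)`;
the hypergeometric series terminates after the term of order `n`. -/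
def jacobiNat (α β : ℝ) (n : ℕ) : ℝ[X] :=
  C ((-1) ^ n * (poch (α + β + 1) n / n.factorial) * (poch (β + 1) n / poch (α + 1) n)) *
    ∑ i ∈ Finset.range (n + 1),
      C (poch (-n) i * poch (n + α + β + 1) i / (i.factorial * poch (β + 1) i)) * X ^ i

/-- The Jacobi polynomials indexed by all integers, `p_n = 0` for `n < 0`. -/
def jacobi (α β : ℝ) : ℤ → ℝ[X]
  | Int.ofNat n => jacobiNat α β n
  | Int.negSucc _ => 0

/-- The discrete Wronskian `Wr_n(F⁽¹⁾, …, F⁽ʳ⁾) = det (F⁽ⁱ⁾_{n-j+1})_{1 ≤ i, j ≤ r}`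
(here `i` and `j` are counted from `0`). -/
def discreteWronskian {R : Type*} [CommRing R] {r : ℕ} (F : Fin r → ℤ → R) (n : ℤ) : R :=
  (Matrix.of fun i j : Fin r => F i (n - (j : ℤ))).det

/-- `ψ_n ∈ (-1)^n ℝ[λ_n^ξ]`. -/
def IsAltPolynomial (ξ : ℝ) (ψ : ℤ → ℝ) : Prop :=
  ∃ g : ℝ[X], ∀ n : ℤ, ψ n = (-1) ^ n * g.eval (lam ξ n)

/-- `τ_n = Wr_n((-1)^n ψ⁽⁰⁾_n, …, (-1)^n ψ⁽ᵏ⁻¹⁾_n)`. -/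
def tau {k : ℕ} (ψ : Fin k → ℤ → ℝ) (n : ℤ) : ℝ :=
  discreteWronskian (fun j l => (-1) ^ l * ψ j l) n

/-- The extended Jacobi polynomial
`q_n(t) = Wr_n(ψ⁽⁰⁾_n, …, ψ⁽ᵏ⁻¹⁾_n, p_n^{α,β}(t))`. -/
def extJacobi (α β : ℝ) {k : ℕ} (ψ : Fin k → ℤ → ℝ) (n : ℤ) : ℝ[X] :=
  discreteWronskian
    (Fin.snoc (α := fun _ => ℤ → ℝ[X]) (fun j l => C (ψ j l)) (fun l => jacobi α β l)) n

/-- The extended Jacobi polynomial with the additional parameter `s`,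
`q̂_{n,s}(t) = Wr_n(ψ⁽⁰⁾_{n+s}, …, ψ⁽ᵏ⁻¹⁾_{n+s}, p_n^{α+2s,β}(t))`. -/
def extJacobiParam (α β : ℝ) {k : ℕ} (ψ : Fin k → ℤ → ℝ) (s : ℕ) (n : ℤ) : ℝ[X] :=
  discreteWronskian
    (Fin.snoc (α := fun _ => ℤ → ℝ[X]) (fun j l => C (ψ j (l + s)))
      (fun l => jacobi (α + 2 * s) β l)) n

/-- The algebra of all polynomials `f` such that
`f(λ^ξ_{n-k/2}) - f(λ^ξ_{n-k/2-1})` is divisible by `τ_{n-1}` in `ℝ[n]`. -/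
def spectralAlgebra (ξ : ℝ) {k : ℕ} (ψ : Fin k → ℤ → ℝ) : Set ℝ[X] :=
  {f | ∃ r : ℝ[X], ∀ n : ℤ,
    f.eval (lam ξ (n - k / 2)) - f.eval (lam ξ (n - k / 2 - 1)) = r.eval (n : ℝ) * tau ψ (n - 1)}

/-! ### The one-variable operators -/

/-- `𝒟₁ = (t - 1) ∂_t`. -/
def opD1 : Module.End ℝ ℝ[X] :=
  LinearMap.mulLeft ℝ (X - 1) * Polynomial.derivative

/-- `𝒟₂ = (1 - t) ∂_t² - (α + 1) ∂_t`. -/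
def opD2 (α : ℝ) : Module.End ℝ ℝ[X] :=
  LinearMap.mulLeft ℝ (1 - X) * Polynomial.derivative ^ 2 - (α + 1) • Polynomial.derivative

/-- The algebra `𝔇_α` generated by `𝒟₁` and `𝒟₂`. -/
def algD (α : ℝ) : Subalgebra ℝ (Module.End ℝ ℝ[X]) := Algebra.adjoin ℝ {opD1, opD2 α}

/-- `𝒟₁` as an element of `𝔇_α`. -/
def genD1 (α : ℝ) : algD α := ⟨opD1, Algebra.subset_adjoin (by simp)⟩

/-- `𝒟₂` as an element of `𝔇_α`. -/
def genD2 (α : ℝ) : algD α := ⟨opD2 α, Algebra.subset_adjoin (by simp)⟩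

/-! ### The multivariable operators

The dimension is `d = m + 1`; the variables `x_1, …, x_d` are `X 0, …, X m`, and the parameters
`γ_1, …, γ_{d+1}` are `γ 0, …, γ (m + 1)`. -/

/-- Multiplication by a polynomial. -/
abbrev mulOp {m : ℕ} (p : MvPolynomial (Fin m) ℝ) : Module.End ℝ (MvPolynomial (Fin m) ℝ) :=
  LinearMap.mulLeft ℝ p

/-- The partial derivative in the `i`-th variable. -/
abbrev partialOp {m : ℕ} (i : Fin m) : Module.End ℝ (MvPolynomial (Fin m) ℝ) :=
  (MvPolynomial.pderiv i).toLinearMap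

/-- `D̂₁ = (x_1 - 1) ∂_{x_1} + ∑_{j=2}^d x_j ∂_{x_j}`. -/
def hatD1 (m : ℕ) : Module.End ℝ (MvPolynomial (Fin (m + 1)) ℝ) :=
  mulOp (MvPolynomial.X 0 - 1) * partialOp 0 +
    ∑ j : Fin m, mulOp (MvPolynomial.X j.succ) * partialOp j.succ

/-- `D̂₂ = (1 - x_1) ∂_{x_1}² + ∑_{j=2}^d x_j ∂_{x_j}² - 2 ∑_{j=2}^d x_j ∂_{x_j} ∂_{x_1}
- (γ_2 + ⋯ + γ_{d+1} + d) ∂_{x_1} + ∑_{j=2}^d (γ_j + 1) ∂_{x_j}`. -/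
def hatD2 {m : ℕ} (γ : Fin (m + 2) → ℝ) : Module.End ℝ (MvPolynomial (Fin (m + 1)) ℝ) :=
  mulOp (1 - MvPolynomial.X 0) * partialOp 0 ^ 2 +
    ∑ j : Fin m, mulOp (MvPolynomial.X j.succ) * partialOp j.succ ^ 2 -
    (2 : ℝ) • ∑ j : Fin m, mulOp (MvPolynomial.X j.succ) * partialOp j.succ * partialOp 0 -
    ((∑ i : Fin (m + 1), γ i.succ) + (m + 1)) • partialOp 0 +
    ∑ j : Fin m, (γ j.succ.castSucc + 1) • partialOp j.succ

/-- The algebra `𝔇̂_γ` generated by `D̂₁` and `D̂₂`. -/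
def hatAlgD {m : ℕ} (γ : Fin (m + 2) → ℝ) :
    Subalgebra ℝ (Module.End ℝ (MvPolynomial (Fin (m + 1)) ℝ)) :=
  Algebra.adjoin ℝ {hatD1 m, hatD2 γ}

/-- `D̂₁` as an element of `𝔇̂_γ`. -/
def hatGenD1 {m : ℕ} (γ : Fin (m + 2) → ℝ) : hatAlgD γ :=
  ⟨hatD1 m, Algebra.subset_adjoin (by simp)⟩

/-- `D̂₂` as an element of `𝔇̂_γ`. -/
def hatGenD2 {m : ℕ} (γ : Fin (m + 2) → ℝ) : hatAlgD γ :=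
  ⟨hatD2 γ, Algebra.subset_adjoin (by simp)⟩

/-! ### Polynomials on the simplex -/

/-- For `p` of total degree at most `N` in `m` variables, the polynomial
`(1 - x_1)^N p(x_2 / (1 - x_1), …, x_{m+1} / (1 - x_1))` in `m + 1` variables
(see `eval_coneLift`). -/
def coneLift {m : ℕ} (N : ℕ) (p : MvPolynomial (Fin m) ℝ) : MvPolynomial (Fin (m + 1)) ℝ :=
  ∑ e ∈ p.support, MvPolynomial.C (p.coeff e) * (1 - MvPolynomial.X 0) ^ (N - ∑ j, e j) *
    ∏ j, MvPolynomial.X j.succ ^ e j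

/-- A one-variable polynomial, evaluated at the first variable `x_1`. -/
def inFirst {m : ℕ} (p : ℝ[X]) : MvPolynomial (Fin (m + 1)) ℝ :=
  Polynomial.aeval (MvPolynomial.X 0) p

/-- The Jacobi polynomials `P_η^γ` on the `d`-dimensional simplex, defined recursively by
`P_η^γ(x) = p_{η_1}^{a_1,b_1}(z_1) (1 - z_1)^{η_2+⋯+η_d} P_{η_2,…,η_d}^{γ_2,…,γ_{d+1}}(z_2,…,z_d)`,
where `z_1 = x_1`, `z_j = x_j / (1 - x_1)`,
`a_1 = 2 (η_2+⋯+η_d) + (γ_2+⋯+γ_{d+1}) + d - 1` and `b_1 = γ_1`. -/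
def simplexJacobi : {d : ℕ} → (Fin (d + 1) → ℝ) → (Fin d → ℕ) → MvPolynomial (Fin d) ℝ
  | 0, _, _ => 1
  | d + 1, γ, η =>
    inFirst (jacobi (2 * (∑ j : Fin d, η j.succ : ℕ) + (∑ i : Fin (d + 1), γ i.succ) + d) (γ 0)
        (η 0)) *
      coneLift (∑ j : Fin d, η j.succ) (simplexJacobi (Fin.tail γ) (Fin.tail η))

/-- The parameter `α = γ_2 + ⋯ + γ_{d+1} + d - 1`, with `d = m + 1`. -/
def alphaOf {m : ℕ} (γ : Fin (m + 2) → ℝ) : ℝ := (∑ i : Fin (m + 1), γ i.succ) + m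

/-- The polynomials
`Q_η^γ(x) = q̂_{η_1,s}(z_1) (1 - z_1)^s P_{η_2,…,η_d}^{γ_2,…,γ_{d+1}}(z_2,…,z_d)` with
`s = η_2 + ⋯ + η_d`, where `z_1 = x_1`, `z_j = x_j / (1 - x_1)`. -/
def polyQ {m k : ℕ} (γ : Fin (m + 2) → ℝ) (ψ : Fin k → ℤ → ℝ) (η : Fin (m + 1) → ℕ) :
    MvPolynomial (Fin (m + 1)) ℝ :=
  inFirst (extJacobiParam (alphaOf γ) (γ 0) ψ (∑ j : Fin m, η j.succ) (η 0)) *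
    coneLift (∑ j : Fin m, η j.succ) (simplexJacobi (Fin.tail γ) (Fin.tail η))

/-! ### The change of variables

The next facts show that `simplexJacobi` and `polyQ` are given by the stated formulas in the
variables `z_1 = x_1`, `z_j = x_j / (1 - x_1)`. -/

theorem eval_inFirst {m : ℕ} (p : ℝ[X]) (x : Fin (m + 1) → ℝ) :
    MvPolynomial.eval x (inFirst p) = p.eval (x 0) := by
  induction p using Polynomial.induction_on' with
  | add p q hp hq => simpa [inFirst] using congrArg₂ (· + ·) hp hq
  | monomial n a => simp [inFirst, Polynomial.aeval_monomial]

theorem eval_coneLift {m : ℕ} {N : ℕ} {p : MvPolynomial (Fin m) ℝ} (hp : p.totalDegree ≤ N)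
    (x : Fin (m + 1) → ℝ) (hx : x 0 ≠ 1) :
    MvPolynomial.eval x (coneLift N p) =
      (1 - x 0) ^ N * MvPolynomial.eval (fun j => x j.succ / (1 - x 0)) p := by
  have h1 : (1 - x 0) ≠ 0 := sub_ne_zero.mpr (Ne.symm hx)
  rw [MvPolynomial.eval_eq' (fun j => x j.succ / (1 - x 0)) p, coneLift, map_sum, Finset.mul_sum]
  refine Finset.sum_congr rfl fun e he => ?_
  have hle : ∑ j, e j ≤ N := by
    have := (MvPolynomial.le_totalDegree he).trans hp
    rwa [Finsupp.sum_fintype _ _ (fun _ => rfl)] at this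
  have hprod : ∏ j, (x j.succ / (1 - x 0)) ^ e j =
      (∏ j, x j.succ ^ e j) / (1 - x 0) ^ (∑ j, e j) := by
    simp [div_pow, Finset.prod_div_distrib, Finset.prod_pow_eq_pow_sum]
  have hpow : (1 - x 0) ^ N = (1 - x 0) ^ (N - ∑ j, e j) * (1 - x 0) ^ (∑ j, e j) := by
    rw [← pow_add, Nat.sub_add_cancel hle]
  have h2 : (1 - x 0) ^ (∑ j, e j) ≠ 0 := pow_ne_zero _ h1
  rw [hprod, hpow]
  simp only [map_mul, map_pow, map_sub, map_one, map_prod, MvPolynomial.eval_C,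
    MvPolynomial.eval_X]
  field_simp

theorem totalDegree_coneLift_le {m : ℕ} {N : ℕ} {p : MvPolynomial (Fin m) ℝ}
    (hp : p.totalDegree ≤ N) : (coneLift N p).totalDegree ≤ N := by
  refine MvPolynomial.totalDegree_finsetSum_le fun e he => ?_
  have hle : ∑ j, e j ≤ N := by
    have := (MvPolynomial.le_totalDegree he).trans hp
    rwa [Finsupp.sum_fintype _ _ (fun _ => rfl)] at this
  have h1 : (1 - MvPolynomial.X 0 : MvPolynomial (Fin (m + 1)) ℝ).totalDegree ≤ 1 :=
    (MvPolynomial.totalDegree_sub _ _).trans (by simp)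
  have h2 : ((1 - MvPolynomial.X 0 : MvPolynomial (Fin (m + 1)) ℝ) ^
      (N - ∑ j, e j)).totalDegree ≤ N - ∑ j, e j :=
    (MvPolynomial.totalDegree_pow _ _).trans (by nlinarith)
  have h3 : (∏ j, (MvPolynomial.X j.succ : MvPolynomial (Fin (m + 1)) ℝ) ^ e j).totalDegree ≤
      ∑ j, e j :=
    (MvPolynomial.totalDegree_finsetProd _ _).trans
      (Finset.sum_le_sum fun j _ => (MvPolynomial.totalDegree_pow _ _).trans (by simp))
  refine (MvPolynomial.totalDegree_mul _ _).trans ?_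
  have h4 := MvPolynomial.totalDegree_mul
    (MvPolynomial.C (p.coeff e) : MvPolynomial (Fin (m + 1)) ℝ)
    ((1 - MvPolynomial.X 0) ^ (N - ∑ j, e j))
  rw [MvPolynomial.totalDegree_C] at h4
  omega

theorem totalDegree_inFirst_le {m : ℕ} (p : ℝ[X]) :
    (inFirst (m := m) p).totalDegree ≤ p.natDegree := by
  rw [inFirst, Polynomial.aeval_eq_sum_range]
  refine MvPolynomial.totalDegree_finsetSum_le fun i hi => ?_
  refine (MvPolynomial.totalDegree_smul_le _ _).trans ?_
  refine (MvPolynomial.totalDegree_pow _ _).trans ?_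
  have := Finset.mem_range.mp hi
  simp only [MvPolynomial.totalDegree_X, mul_one]
  omega

theorem natDegree_jacobi_le (α β : ℝ) (n : ℕ) : (jacobi α β n).natDegree ≤ n := by
  change (jacobiNat α β n).natDegree ≤ n
  refine (Polynomial.natDegree_C_mul_le _ _).trans ?_
  refine Polynomial.natDegree_sum_le_of_forall_le _ _ fun i hi => ?_
  have := Finset.mem_range.mp hi
  exact (Polynomial.natDegree_C_mul_X_pow_le _ _).trans (by omega)

theorem totalDegree_simplexJacobi_le : ∀ {d : ℕ} (γ : Fin (d + 1) → ℝ) (η : Fin d → ℕ),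
    (simplexJacobi γ η).totalDegree ≤ ∑ j, η j
  | 0, _, _ => by simp [simplexJacobi]
  | d + 1, γ, η => by
    rw [simplexJacobi, Fin.sum_univ_succ (f := η)]
    refine (MvPolynomial.totalDegree_mul _ _).trans (add_le_add ?_ ?_)
    · exact (totalDegree_inFirst_le _).trans (natDegree_jacobi_le _ _ _)
    · exact totalDegree_coneLift_le (totalDegree_simplexJacobi_le (Fin.tail γ) (Fin.tail η))

theorem eval_simplexJacobi {d : ℕ} (γ : Fin (d + 2) → ℝ) (η : Fin (d + 1) → ℕ)
    (x : Fin (d + 1) → ℝ) (hx : x 0 ≠ 1) :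
    MvPolynomial.eval x (simplexJacobi γ η) =
      (jacobi (2 * (∑ j : Fin d, η j.succ : ℕ) + (∑ i : Fin (d + 1), γ i.succ) + d) (γ 0)
        (η 0)).eval (x 0) * ((1 - x 0) ^ (∑ j : Fin d, η j.succ) *
      MvPolynomial.eval (fun j => x j.succ / (1 - x 0))
        (simplexJacobi (Fin.tail γ) (Fin.tail η))) := by
  rw [simplexJacobi, map_mul, eval_inFirst,
    eval_coneLift (N := ∑ j : Fin d, η j.succ)
      (totalDegree_simplexJacobi_le (Fin.tail γ) (Fin.tail η)) x hx]

theorem eval_polyQ {m k : ℕ} (γ : Fin (m + 2) → ℝ) (ψ : Fin k → ℤ → ℝ) (η : Fin (m + 1) → ℕ)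
    (x : Fin (m + 1) → ℝ) (hx : x 0 ≠ 1) :
    MvPolynomial.eval x (polyQ γ ψ η) =
      (extJacobiParam (alphaOf γ) (γ 0) ψ (∑ j : Fin m, η j.succ) (η 0)).eval (x 0) *
      ((1 - x 0) ^ (∑ j : Fin m, η j.succ) *
      MvPolynomial.eval (fun j => x j.succ / (1 - x 0))
        (simplexJacobi (Fin.tail γ) (Fin.tail η))) := by
  rw [polyQ, map_mul, eval_inFirst,
    eval_coneLift (N := ∑ j : Fin m, η j.succ)
      (totalDegree_simplexJacobi_le (Fin.tail γ) (Fin.tail η)) x hx]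

end AppellLauricella

end

/-!
The multivariable statement is a consequence of the one-variable one, because a linear map carries
the one-variable polynomials to the multivariable ones and intertwines the two algebras.

In one variable put `u = 1 - t` and `ξ = α + β + 1`. Then `𝒟₁ uʲ = j uʲ` and
`𝒟₂ uʲ = j (j + α) uʲ⁻¹`, and the hypergeometric operator is `L = 𝒟₂ - 𝒟₁² - ξ 𝒟₁`. The Jacobi
polynomials satisfy `L p_n = λ_n p_n` (`jacobiOp_jacobi`) and
`𝒟₁ (p_n + p_{n-1}) = n p_n - (n + ξ - 1) p_{n-1}` (`opD1_jacobi_add`). Both are read off from their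
expansion in powers of `u` (`jacobiNat_eq_sum`).

The eigenvalue equation for `q_n` is a discrete Darboux transformation
(`discreteWronskian_intertwining`). Remove the signs by `p̃_n = (-1)ⁿ p_n`, and let
`F_n = f(λ_{n-k/2})` with `F_n - F_{n-1} = r_n τ_{n-1}`. Cramer's rule shows that
`F_{n+k} p̃_n - ∑ᵢ w⁽ⁱ⁾_n S⁽ⁱ⁾_n`, with `w⁽ⁱ⁾_n = (-1)ⁿ ψ⁽ⁱ⁾_n`, is carried by the Wronskian to
`F_n` times the Wronskian of `p̃`; here `S⁽ⁱ⁾` is a discrete integral of `p̃` whose weight is a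
polynomial in `n` built from `r` and the minors of `τ`. The weight is odd under `n ↦ -ξ - n`
(`exists_adjointWeight_poly`), hence of the form `(n + ξ/2) q(λ_n)`; and the two relations for the
Jacobi polynomials express the discrete integral with such a weight by an element of `𝔇_α`. This
gives `ℬ_f` (`exists_mem_algD_apply_extJacobi`).

In several variables let `P` be a Jacobi polynomial of degree `s` in one variable less, and
`H = (1 - x_1)ˢ P(x' / (1 - x_1))`. By the differential equation on the simplex
(`simplexOp_simplexJacobi`), `D̂₁` and `D̂₂` act on `g(x_1) H` as `𝒟₁ + s` and as `𝒟₂` with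
parameter `α + 2s`. This representation is a quotient of the one on `ℝ[t]`: the map `intertwiner`,
which kills `uⁱ` for `i < s` and sends `u^{j+s}` to a multiple of `(1 - x_1)ʲ H`, intertwines the
generators. It sends `p_N^{α,β}` to a multiple of `p_{N-s}^{α+2s,β} H` with a factor independent
of `N`, so it sends `q_{|η|}` to a nonzero multiple of `Q_η` (`simplexIntertwiner_extJacobi`).
Since the `Q_η` form a basis, an operator in `𝔇̂_γ` is determined by the corresponding one in
`𝔇_α`; for `s = 0` the map is injective, which gives the converse. This yields the isomorphism
(`exists_algEquiv_simplexIntertwiner`) and transports the eigenvalue equation.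

The `Q_η` are linearly independent since, for fixed `x_1`, they are multiples of Jacobi polynomials
in `x' / (1 - x_1)`; they span by a dimension count in each degree.
-/

open Polynomial

namespace AppellLauricella

/-! ### Pochhammer symbols and terminating hypergeometric series -/

theorem poch_zero (x : ℝ) : poch x 0 = 1 := by simp [poch]

theorem poch_succ (x : ℝ) (i : ℕ) : poch x (i + 1) = poch x i * (x + i) := by
  simp [poch, ascPochhammer_succ_eval]

theorem poch_succ_left (x : ℝ) (i : ℕ) : poch x (i + 1) = x * poch (x + 1) i := by
  simp [poch, ascPochhammer_succ_left, eval_comp]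

theorem poch_add (x : ℝ) (m n : ℕ) : poch x (m + n) = poch x m * poch (x + m) n := by
  induction n with
  | zero => simp [poch_zero]
  | succ n ih => rw [← add_assoc, poch_succ, poch_succ, ih]; push_cast; ring

theorem poch_pos {x : ℝ} (hx : 0 < x) (i : ℕ) : 0 < poch x i := ascPochhammer_pos i x hx

theorem poch_ne_zero {x : ℝ} (hx : -1 < x) (hx0 : x ≠ 0) (i : ℕ) : poch x i ≠ 0 := by
  cases i with
  | zero => simp [poch_zero]
  | succ i => rw [poch_succ_left]; exact mul_ne_zero hx0 (poch_pos (by linarith) i).ne'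

theorem poch_neg_natCast (n i : ℕ) (h : i ≤ n) :
    poch (-n) i = (-1) ^ i * n.factorial / (n - i).factorial := by
  induction i with
  | zero => simp [poch_zero, Nat.factorial_ne_zero]
  | succ i ih =>
    have h1 : n - i = (n - (i + 1)) + 1 := by omega
    have h2 : (n : ℝ) = ((n - (i + 1) : ℕ) : ℝ) + i + 1 := by
      rw [Nat.cast_sub h]; push_cast; ring
    rw [poch_succ, ih (by omega), h1, Nat.factorial_succ]
    have h3 : (-(n : ℝ) + i) = -(((n - (i + 1) : ℕ) : ℝ) + 1) := by rw [h2]; simp; ring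
    rw [h3]
    have := Nat.factorial_ne_zero (n - (i + 1))
    have h4 : (((n - (i + 1) : ℕ) : ℝ) + 1) ≠ 0 := by positivity
    push_cast
    field_simp
    ring

theorem poch_neg_natCast_of_lt (n i : ℕ) (h : n < i) : poch (-n) i = 0 := by
  induction i with
  | zero => omega
  | succ i ih =>
    rw [poch_succ]
    rcases Nat.lt_succ_iff_lt_or_eq.mp h with h | rfl
    · rw [ih h, zero_mul]
    · simp

/-- The `i`-th coefficient of the terminating series `₂F₁(-n, n + ξ; c; ·)`. -/
noncomputable def hypCoeff (ξ c : ℝ) (n i : ℕ) : ℝ :=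
  poch (-n) i * poch (n + ξ) i / (i.factorial * poch c i)

theorem hypCoeff_of_lt (ξ c : ℝ) {n i : ℕ} (h : n < i) : hypCoeff ξ c n i = 0 := by
  simp [hypCoeff, poch_neg_natCast_of_lt n i h]

theorem hypCoeff_succ (ξ : ℝ) {c : ℝ} (hc : 0 < c) (n i : ℕ) :
    (i + 1) * (i + c) * hypCoeff ξ c n (i + 1) = (i * (i + ξ) + lam ξ n) * hypCoeff ξ c n i := by
  have h1 := (poch_pos hc i).ne'
  have h2 : c + i ≠ 0 := by positivity
  have h3 : (i.factorial : ℝ) ≠ 0 := by positivity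
  simp only [hypCoeff, poch_succ, Nat.factorial_succ, lam]
  push_cast
  field_simp
  ring

/-- A terminating hypergeometric series in any sequence of vectors on which an operator acts as
the hypergeometric operator acts on powers of its variable is an eigenvector. The same statement
serves for the expansions of a Jacobi polynomial at both end points. -/
theorem apply_sum_hypCoeff {V : Type*} [AddCommGroup V] [Module ℝ V] (L : Module.End ℝ V)
    (y : ℕ → V) (ξ : ℝ) {c : ℝ} (hc : 0 < c) (h0 : L (y 0) = 0)
    (h : ∀ i : ℕ, L (y (i + 1)) =
      ((i + 1) * (i + c) : ℝ) • y i - ((i + 1) * (i + 1 + ξ) : ℝ) • y (i + 1)) (n : ℕ) :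
    L (∑ i ∈ Finset.range (n + 1), hypCoeff ξ c n i • y i) =
      lam ξ n • ∑ i ∈ Finset.range (n + 1), hypCoeff ξ c n i • y i := by
  have key : ∀ N : ℕ, L (∑ i ∈ Finset.range (N + 1), hypCoeff ξ c n i • y i) =
      lam ξ n • ∑ i ∈ Finset.range (N + 1), hypCoeff ξ c n i • y i -
        ((N * (N + ξ) + lam ξ n) * hypCoeff ξ c n N) • y N := by
    intro N
    induction N with
    | zero => simp [h0]; module
    | succ N ih =>
      rw [Finset.sum_range_succ, map_add, ih, map_smul, h, smul_sub, smul_smul,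
        ← hypCoeff_succ ξ hc n N]
      push_cast
      module
  rw [key n]
  have : (n : ℝ) * (n + ξ) + lam ξ n = 0 := by simp [lam]
  rw [this]
  simp

/-! ### Jacobi polynomials -/

/-- Two linear maps on `ℝ[t]` which agree on the powers of `1 - t` are equal. -/
theorem linearMap_ext_one_sub {V : Type*} [AddCommGroup V] [Module ℝ V] {f g : ℝ[X] →ₗ[ℝ] V}
    (h : ∀ n : ℕ, f ((1 - X) ^ n) = g ((1 - X) ^ n)) : f = g := by
  have hcomp : ∀ p : ℝ[X], f (p.comp (1 - X)) = g (p.comp (1 - X)) := by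
    intro p
    induction p using Polynomial.induction_on' with
    | add p q hp hq => simp [hp, hq]
    | monomial n a => simp [← smul_eq_C_mul, h]
  refine LinearMap.ext fun p => ?_
  have : (p.comp (1 - X)).comp (1 - X) = p := by simp [comp_assoc]
  rw [← this, hcomp]

theorem opD1_apply (p : ℝ[X]) : opD1 p = (X - 1) * derivative p := by simp [opD1]

theorem opD2_apply (α : ℝ) (p : ℝ[X]) :
    opD2 α p = (1 - X) * derivative (derivative p) - (α + 1) • derivative p := by
  simp [opD2, pow_two]

theorem derivative_one_sub_pow (n : ℕ) :
    derivative ((1 - X : ℝ[X]) ^ (n + 1)) = -((n + 1 : ℝ) • (1 - X) ^ n) := by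
  rw [derivative_pow_succ, smul_eq_C_mul]
  simp

theorem opD1_one_sub_pow (n : ℕ) : opD1 ((1 - X) ^ n) = (n : ℝ) • (1 - X) ^ n := by
  cases n with
  | zero => simp [opD1_apply]
  | succ n =>
    rw [opD1_apply, derivative_one_sub_pow, pow_succ]
    simp only [smul_eq_C_mul]
    push_cast
    simp only [map_add, map_one, map_natCast]
    ring

theorem opD2_one_sub_pow (α : ℝ) (n : ℕ) :
    opD2 α ((1 - X) ^ (n + 1)) = ((n + 1) * (n + 1 + α) : ℝ) • (1 - X) ^ n := by
  rw [opD2_apply, derivative_one_sub_pow]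
  cases n with
  | zero => simp [add_comm]
  | succ n =>
    rw [map_neg, map_smul, derivative_one_sub_pow, pow_succ]
    simp only [smul_eq_C_mul]
    push_cast
    simp only [map_add, map_one, map_natCast, map_mul]
    ring

/-- The hypergeometric operator `𝒟₂ - 𝒟₁² - ξ 𝒟₁`, which for `ξ = α + β + 1` equals
`t (1 - t) ∂_t² + (β + 1 - (α + β + 2) t) ∂_t`. -/
noncomputable def jacobiOp (α ξ : ℝ) : Module.End ℝ ℝ[X] := opD2 α - opD1 ^ 2 - ξ • opD1

theorem jacobiOp_apply (α ξ : ℝ) (p : ℝ[X]) :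
    jacobiOp α ξ p = opD2 α p - opD1 (opD1 p) - ξ • opD1 p := by
  simp [jacobiOp, pow_two]

theorem jacobiOp_X_pow_succ (α β : ℝ) (i : ℕ) :
    jacobiOp α (α + β + 1) (X ^ (i + 1)) = ((i + 1) * (i + (β + 1)) : ℝ) • X ^ i -
      ((i + 1) * (i + 1 + (α + β + 1)) : ℝ) • X ^ (i + 1) := by
  rw [jacobiOp_apply]
  simp only [opD1_apply, opD2_apply, smul_eq_C_mul]
  cases i with
  | zero =>
    simp
    ring
  | succ n =>
    simp only [derivative_mul, derivative_pow_succ, derivative_sub, derivative_X, derivative_one,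
      derivative_natCast, map_add, map_one, map_natCast, map_mul]
    push_cast
    ring

theorem jacobiOp_one_sub_pow_succ (α ξ : ℝ) (i : ℕ) :
    jacobiOp α ξ ((1 - X) ^ (i + 1)) = ((i + 1) * (i + (α + 1)) : ℝ) • (1 - X) ^ i -
      ((i + 1) * (i + 1 + ξ) : ℝ) • (1 - X) ^ (i + 1) := by
  rw [jacobiOp_apply, opD2_one_sub_pow, opD1_one_sub_pow, map_smul, opD1_one_sub_pow]
  push_cast
  module

theorem jacobiOp_one (α ξ : ℝ) : jacobiOp α ξ 1 = 0 := by
  simp [jacobiOp_apply, opD1_apply, opD2_apply]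

theorem coeff_jacobiOp (α β : ℝ) (p : ℝ[X]) (i : ℕ) :
    (jacobiOp α (α + β + 1) p).coeff i =
      (i + 1) * (i + (β + 1)) * p.coeff (i + 1) - i * (i + (α + β + 1)) * p.coeff i := by
  induction p using Polynomial.induction_on' with
  | add p q hp hq => rw [map_add, coeff_add, hp, hq, coeff_add, coeff_add]; ring
  | monomial n a =>
    rw [← mul_one a, ← smul_eq_mul, ← smul_monomial, map_smul, monomial_one_right_eq_X_pow]
    cases n with
    | zero =>
      rw [pow_zero, jacobiOp_one]
      cases i <;> simp [coeff_one]
    | succ n =>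
      rw [jacobiOp_X_pow_succ]
      simp only [coeff_smul, coeff_sub, coeff_X_pow, smul_eq_mul]
      by_cases h1 : i = n
      · subst h1; simp [mul_comm]
      · by_cases h2 : i = n + 1
        · subst h2; simp [mul_comm]
        · have h3 : ¬ i + 1 = n + 1 := by omega
          simp [h1, h2]

/-- An eigenfunction of the hypergeometric operator with the eigenvalue of degree `n` vanishes
once its degree is less than `n`, because the eigenvalues of different degrees are different. -/
theorem eq_zero_of_jacobiOp_eq {α β : ℝ} (h : -1 < α + β + 1) {n : ℕ} {p : ℝ[X]}
    (hp : p.degree < n) (hL : jacobiOp α (α + β + 1) p = lam (α + β + 1) n • p) : p = 0 := by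
  by_contra hne
  have hlt : p.natDegree < n := (natDegree_lt_iff_degree_lt hne).mpr hp
  have hc := congrArg (fun q => q.coeff p.natDegree) hL
  simp only [coeff_jacobiOp, coeff_smul, smul_eq_mul,
    coeff_eq_zero_of_natDegree_lt (Nat.lt_succ_self p.natDegree), mul_zero, lam] at hc
  have hl : p.coeff p.natDegree ≠ 0 := by simpa using hne
  set i := p.natDegree
  have h1 : (i : ℝ) + 1 ≤ n := by exact_mod_cast hlt
  have h2 : ((n : ℝ) - i) * (n + i + (α + β + 1)) * p.coeff i = 0 := by linear_combination hc
  have h3 : (n : ℝ) - i ≠ 0 := by linarith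
  have h4 : (n : ℝ) + i + (α + β + 1) ≠ 0 := by
    have : (0 : ℝ) ≤ i := by positivity
    linarith
  exact mul_ne_zero (mul_ne_zero h3 h4) hl h2

/-- The coefficient of `(1 - t)^i` in the Jacobi polynomial of degree `n`, with `ξ = α + β + 1`. -/
noncomputable def jacobiCoeff (α ξ : ℝ) (n i : ℕ) : ℝ :=
  poch ξ n / n.factorial * hypCoeff ξ (α + 1) n i

theorem jacobiCoeff_of_le {α ξ : ℝ} {n i : ℕ} (h : i ≤ n) :
    jacobiCoeff α ξ n i = (-1) ^ i * poch ξ (n + i) /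
      ((n - i).factorial * (i.factorial * poch (α + 1) i)) := by
  rw [jacobiCoeff, hypCoeff, poch_neg_natCast n i h, poch_add, add_comm ξ n]
  have : (n.factorial : ℝ) ≠ 0 := by positivity
  field_simp

/-- The expansion of the Jacobi polynomials at `t = 1`. Both sides are eigenfunctions of the
hypergeometric operator for the same eigenvalue, so it suffices to compare leading coefficients. -/
theorem jacobiNat_eq_sum {α β : ℝ} (hα : -1 < α) (hβ : -1 < β) (n : ℕ) :
    jacobiNat α β n =
      ∑ i ∈ Finset.range (n + 1), jacobiCoeff α (α + β + 1) n i • (1 - X : ℝ[X]) ^ i := by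
  set ξ := α + β + 1 with hξ
  set c : ℝ := (-1) ^ n * (poch (α + β + 1) n / n.factorial) * (poch (β + 1) n / poch (α + 1) n)
  have hleft : jacobiNat α β n =
      c • ∑ i ∈ Finset.range (n + 1), hypCoeff ξ (β + 1) n i • X ^ i := by
    rw [jacobiNat, smul_eq_C_mul]
    congr 1
    refine Finset.sum_congr rfl fun i _ => ?_
    rw [smul_eq_C_mul, hypCoeff, hξ, ← add_assoc, ← add_assoc]
  have hright : ∑ i ∈ Finset.range (n + 1), jacobiCoeff α ξ n i • (1 - X : ℝ[X]) ^ i =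
      (poch ξ n / n.factorial) •
        ∑ i ∈ Finset.range (n + 1), hypCoeff ξ (α + 1) n i • (1 - X) ^ i := by
    simp only [jacobiCoeff, Finset.smul_sum, smul_smul]
  rw [← sub_eq_zero]
  refine eq_zero_of_jacobiOp_eq (α := α) (β := β) (by linarith) (n := n) ?_ ?_
  · rw [degree_lt_iff_coeff_zero]
    intro k hk
    rcases hk.eq_or_lt with rfl | hk
    · have e1 : (jacobiNat α β n).coeff n = c * hypCoeff ξ (β + 1) n n := by
        rw [hleft]
        simp [coeff_X_pow]
      have e2 : (∑ i ∈ Finset.range (n + 1), jacobiCoeff α ξ n i • (1 - X : ℝ[X]) ^ i).coeff n =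
          (-1) ^ n * jacobiCoeff α ξ n n := by
        have hpow : ∀ i : ℕ, (1 - X : ℝ[X]) ^ i = (-1) ^ i * (X - 1) ^ i := fun i => by
          rw [← mul_pow]; congr 1; ring
        rw [Finset.sum_range_succ, coeff_add, finsetSum_coeff, Finset.sum_eq_zero, zero_add,
          coeff_smul, hpow]
        · have : ((X - 1 : ℝ[X]) ^ n).coeff n = 1 := by
            have := ((monic_X_sub_C (1 : ℝ)).pow n).coeff_natDegree
            rwa [natDegree_pow, natDegree_X_sub_C, mul_one, map_one] at this
          have h' : ((-1 : ℝ[X]) ^ n) = C ((-1) ^ n) := by simp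
          rw [h', coeff_C_mul, this]
          simp [mul_comm]
        · intro i hi
          have hi := Finset.mem_range.mp hi
          rw [coeff_smul, coeff_eq_zero_of_natDegree_lt, smul_zero]
          refine lt_of_le_of_lt natDegree_pow_le ?_
          have : (1 - X : ℝ[X]).natDegree ≤ 1 := by
            refine (natDegree_sub_le _ _).trans ?_
            simp
          nlinarith
      rw [coeff_sub, e1, e2]
      have hp1 := (poch_pos (show 0 < α + 1 by linarith) n).ne'
      have hp2 := (poch_pos (show 0 < β + 1 by linarith) n).ne'
      simp only [jacobiCoeff, hypCoeff, c, ← hξ]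
      field_simp
      ring
    · rw [coeff_sub, coeff_eq_zero_of_natDegree_lt, coeff_eq_zero_of_natDegree_lt, sub_zero]
      · refine lt_of_le_of_lt (natDegree_sum_le_of_forall_le (n := n) _ _ fun i hi => ?_) hk
        have hi := Finset.mem_range.mp hi
        refine (natDegree_smul_le _ _).trans (natDegree_pow_le.trans ?_)
        have : (1 - X : ℝ[X]).natDegree ≤ 1 := by
          refine (natDegree_sub_le _ _).trans ?_
          simp
        nlinarith
      · exact lt_of_le_of_lt (natDegree_jacobi_le α β n) hk
  · rw [map_sub, smul_sub]
    congr 1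
    · rw [hleft, map_smul, apply_sum_hypCoeff _ _ ξ (by linarith)
        (by simpa using jacobiOp_one α _) (fun i => jacobiOp_X_pow_succ α β i), smul_comm]
    · rw [hright, map_smul, apply_sum_hypCoeff _ _ ξ (by linarith)
        (by simpa using jacobiOp_one α _) (fun i => jacobiOp_one_sub_pow_succ α _ i), smul_comm]

theorem jacobiOp_jacobi {α β : ℝ} (hα : -1 < α) (hβ : -1 < β) (n : ℤ) :
    jacobiOp α (α + β + 1) (jacobi α β n) = lam (α + β + 1) n • jacobi α β n := by
  cases n with
  | negSucc n => simp [jacobi]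
  | ofNat n =>
    have hright : jacobi α β (Int.ofNat n) = (poch (α + β + 1) n / n.factorial) •
        ∑ i ∈ Finset.range (n + 1), hypCoeff (α + β + 1) (α + 1) n i • (1 - X) ^ i := by
      simp only [jacobi, jacobiNat_eq_sum hα hβ, jacobiCoeff, Finset.smul_sum, smul_smul]
    rw [hright, map_smul, apply_sum_hypCoeff _ _ (α + β + 1) (by linarith)
        (by simpa using jacobiOp_one α _) (fun i => jacobiOp_one_sub_pow_succ α _ i), smul_comm]
    simp

theorem jacobiCoeff_succ (α ξ : ℝ) (n i : ℕ) :
    (n + 1 - i) * jacobiCoeff α ξ (n + 1) i = (n + ξ + i) * jacobiCoeff α ξ n i := by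
  have h1 : poch (-(n + 1 : ℕ)) i * (-(n + 1 : ℕ) + i) = -(n + 1 : ℕ) * poch (-n) i := by
    rw [← poch_succ, poch_succ_left]; push_cast; ring_nf
  have h2 : poch (n + ξ) i * (n + ξ + i) = (n + ξ) * poch ((n + 1 : ℕ) + ξ) i := by
    rw [← poch_succ, poch_succ_left]; push_cast; ring_nf
  push_cast at h1 h2
  have h3 : (n : ℝ) + 1 ≠ 0 := by positivity
  simp only [jacobiCoeff, hypCoeff, poch_succ, Nat.factorial_succ]
  push_cast
  have e1 : (n + 1 - i : ℝ) * poch (-1 + -n) i = (n + 1) * poch (-n) i := by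
    have : (-1 + -n : ℝ) = -(n + 1) := by ring
    rw [this]; linear_combination -h1
  have e0 : (-(n + 1 : ℝ)) = -1 + -n := by ring
  rw [e0]
  calc _ = (poch ξ n * (ξ + n)) / ((n + 1) * n.factorial) *
        (((n + 1 - i : ℝ) * poch (-1 + -n) i) * poch (n + 1 + ξ) i /
          (i.factorial * poch (α + 1) i)) := by ring
    _ = poch ξ n / n.factorial * (poch (-n) i * ((n + ξ) * poch (n + 1 + ξ) i) /
          (i.factorial * poch (α + 1) i)) := by
      rw [e1]; field_simp; ring
    _ = _ := by rw [← h2]; ring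

/-- The first order relation between neighbouring Jacobi polynomials. Together with the
differential equation it determines the action of `𝔇_α` on the whole sequence. -/
theorem opD1_jacobi_add {α β : ℝ} (hα : -1 < α) (hβ : -1 < β) (n : ℤ) :
    opD1 (jacobi α β n + jacobi α β (n - 1)) =
      (n : ℝ) • jacobi α β n - (n + (α + β + 1) - 1 : ℝ) • jacobi α β (n - 1) := by
  rcases lt_trichotomy n 0 with h | h | h
  · obtain ⟨a, rfl⟩ := Int.eq_negSucc_of_lt_zero h
    obtain ⟨b, hb⟩ := Int.eq_negSucc_of_lt_zero (show Int.negSucc a - 1 < 0 by omega)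
    rw [hb]
    simp [jacobi]
  · subst h
    have : jacobi α β 0 = 1 := by
      change jacobiNat α β 0 = 1
      simp [jacobiNat, poch_zero]
    have h' : jacobi α β (0 - 1) = 0 := rfl
    rw [h', this]
    simp [opD1_apply]
  · obtain ⟨k, rfl⟩ := Int.eq_succ_of_zero_lt h
    rw [add_sub_cancel_right]
    change opD1 (jacobiNat α β (k + 1) + jacobiNat α β k) =
      (((k + 1 : ℕ) : ℤ) : ℝ) • jacobiNat α β (k + 1) -
        ((((k + 1 : ℕ) : ℤ) : ℝ) + (α + β + 1) - 1) • jacobiNat α β k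
    have hk : jacobiNat α β k = ∑ i ∈ Finset.range (k + 1 + 1),
        jacobiCoeff α (α + β + 1) k i • (1 - X : ℝ[X]) ^ i := by
      rw [Finset.sum_range_succ, ← jacobiNat_eq_sum hα hβ, jacobiCoeff,
        hypCoeff_of_lt _ _ (Nat.lt_succ_self k)]
      simp
    rw [hk, jacobiNat_eq_sum hα hβ, map_add, map_sum, map_sum, Finset.smul_sum, Finset.smul_sum,
      ← Finset.sum_add_distrib, ← Finset.sum_sub_distrib]
    refine Finset.sum_congr rfl fun i _ => ?_
    have := jacobiCoeff_succ α (α + β + 1) k i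
    simp only [map_smul, opD1_one_sub_pow, smul_smul, ← add_smul, ← sub_smul]
    congr 1
    push_cast
    linear_combination -this

theorem degree_jacobi {α β : ℝ} (hα : -1 < α) (hβ : -1 < β) (h0 : α + β + 1 ≠ 0) (n : ℕ) :
    (jacobi α β n).degree = n := by
  refine le_antisymm ?_ ?_
  · exact degree_le_of_natDegree_le (natDegree_jacobi_le α β n)
  · refine le_degree_of_ne_zero ?_
    change (jacobiNat α β n).coeff n ≠ 0
    have hx : (n : ℝ) + α + β + 1 = α + β + 1 + n := by ring
    have e1 : poch (α + β + 1) n * poch (α + β + 1 + n) n ≠ 0 := by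
      rw [← poch_add]; exact poch_ne_zero (by linarith) h0 _
    rw [jacobiNat, coeff_C_mul, finsetSum_coeff, Finset.sum_eq_single n]
    · have h2 : poch (-n : ℝ) n ≠ 0 := by
        rw [poch_neg_natCast n n le_rfl]
        have := Nat.factorial_ne_zero n
        simp [this]
      have hp1 := (poch_pos (show 0 < α + 1 by linarith) n).ne'
      have hp2 := (poch_pos (show 0 < β + 1 by linarith) n).ne'
      simp only [coeff_C_mul, coeff_X_pow, if_true, mul_one, hx]
      have := left_ne_zero_of_mul e1
      have := right_ne_zero_of_mul e1
      have := Nat.factorial_ne_zero n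
      have h1 : ((-1 : ℝ)) ^ n ≠ 0 := by simp
      positivity
    · intro i _ hi
      simp [coeff_X_pow, hi.symm]
    · simp

/-! ### Discrete Wronskians -/

/-- The coefficients of the expansion of `Wr_n(w⁽⁰⁾, …, w⁽ᵏ⁻¹⁾, p)` along its last row. -/
noncomputable def wronskianCoeff {k : ℕ} (w : Fin k → ℤ → ℝ) (n : ℤ) (j : Fin (k + 1)) : ℝ :=
  (-1) ^ (k + (j : ℕ)) *
    (Matrix.of fun a b : Fin k => w a (n - ((j.succAbove b : Fin (k + 1)) : ℤ))).det

theorem discreteWronskian_snoc {R : Type*} [CommRing R] [Algebra ℝ R] {k : ℕ}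
    (w : Fin k → ℤ → ℝ) (p : ℤ → R) (n : ℤ) :
    discreteWronskian (Fin.snoc (α := fun _ => ℤ → R) (fun j l => algebraMap ℝ R (w j l)) p) n =
      ∑ j : Fin (k + 1), wronskianCoeff w n j • p (n - (j : ℤ)) := by
  rw [discreteWronskian, Matrix.det_succ_row _ (Fin.last k)]
  refine Finset.sum_congr rfl fun j _ => ?_
  have h : (Matrix.of fun i j : Fin (k + 1) =>
      (Fin.snoc (α := fun _ => ℤ → R) (fun j l => algebraMap ℝ R (w j l)) p : Fin (k + 1) → ℤ → R)
        i (n - (j : ℤ))).submatrix (Fin.last k).succAbove j.succAbove =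
      (algebraMap ℝ R).mapMatrix
        (Matrix.of fun a b : Fin k => w a (n - ((j.succAbove b : Fin (k + 1)) : ℤ))) := by
    ext a b
    simp
  rw [h, ← RingHom.map_det, Matrix.of_apply, Fin.snoc_last, Fin.val_last, wronskianCoeff,
    Algebra.smul_def, map_mul, map_pow, map_neg, map_one]
  ring

/-- A discrete Wronskian with a repeated entry vanishes. -/
theorem sum_wronskianCoeff_mul {k : ℕ} (w : Fin k → ℤ → ℝ) (n : ℤ) (i : Fin k) :
    ∑ j : Fin (k + 1), wronskianCoeff w n j * w i (n - (j : ℤ)) = 0 := by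
  have h := discreteWronskian_snoc w (w i) n
  simp only [smul_eq_mul] at h
  rw [← h, discreteWronskian]
  refine Matrix.det_zero_of_row_eq (i := i.castSucc) (j := Fin.last k)
    (Fin.castSucc_lt_last i).ne ?_
  ext j
  simp

theorem wronskianCoeff_zero {k : ℕ} (w : Fin k → ℤ → ℝ) (n : ℤ) :
    wronskianCoeff w n 0 = (-1) ^ k * discreteWronskian w (n - 1) := by
  have h : (Matrix.of fun a b : Fin k =>
      w a (n - (((0 : Fin (k + 1)).succAbove b : Fin (k + 1)) : ℤ))) =
      Matrix.of fun a b : Fin k => w a (n - 1 - (b : ℤ)) := by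
    ext a b
    simp only [Matrix.of_apply, Fin.succAbove_zero, Fin.val_succ]
    congr 1
    push_cast
    ring
  rw [wronskianCoeff, discreteWronskian, h, Fin.val_zero, add_zero]

theorem discreteWronskian_mul {R : Type*} [CommRing R] {r : ℕ} (c : ℤ → R) (F : Fin r → ℤ → R)
    (n : ℤ) :
    discreteWronskian (fun i l => c l * F i l) n =
      (∏ j : Fin r, c (n - (j : ℤ))) * discreteWronskian F n := by
  rw [discreteWronskian, discreteWronskian, ← Matrix.det_mul_row]
  rfl

/-- The matrix `(w⁽ⁱ⁾_{N-j})` whose determinant is the discrete Wronskian. -/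
def wronskianMatrix {k : ℕ} (w : Fin k → ℤ → ℝ) (N : ℤ) : Matrix (Fin k) (Fin k) ℝ :=
  Matrix.of fun i j => w i (N - (j : ℤ))

/-- Cramer's rule for the matrix of a discrete Wronskian. -/
theorem sum_mul_adjugate_wronskianMatrix {k : ℕ} (w : Fin k → ℤ → ℝ) (N : ℤ) (j j₀ : Fin k) :
    ∑ i, w i (N - (j₀ : ℤ)) * (wronskianMatrix w N).adjugate j i =
      if j = j₀ then discreteWronskian w N else 0 := by
  have h := congrFun (congrFun (Matrix.adjugate_mul (wronskianMatrix w N)) j) j₀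
  rw [Matrix.mul_apply, Matrix.smul_apply, Matrix.one_apply] at h
  simp only [smul_eq_mul, mul_ite, mul_one, mul_zero] at h
  rw [show discreteWronskian w N = (wronskianMatrix w N).det from rfl, ← h]
  exact Finset.sum_congr rfl fun i _ => mul_comm _ _

section Summation

variable {V : Type*} [AddCommGroup V] [Module ℝ V] {k : ℕ}

theorem sum_smul_sum_adjugate (w : Fin k → ℤ → ℝ) (N : ℤ) (j₀ : Fin k) (c : ℝ) (y : Fin k → V) :
    ∑ i, w i (N - (j₀ : ℤ)) • ∑ j, (c * (wronskianMatrix w N).adjugate j i) • y j =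
      (c * discreteWronskian w N) • y j₀ := by
  simp only [Finset.smul_sum, smul_smul]
  rw [Finset.sum_comm]
  have h : ∀ j, ∑ i, (w i (N - (j₀ : ℤ)) * (c * (wronskianMatrix w N).adjugate j i)) • y j =
      (c * if j = j₀ then discreteWronskian w N else 0) • y j := by
    intro j
    rw [← Finset.sum_smul, ← sum_mul_adjugate_wronskianMatrix w N j j₀, Finset.mul_sum]
    congr 1
    exact Finset.sum_congr rfl fun i _ => by ring
  simp only [h]
  rw [Finset.sum_eq_single j₀]
  · simp
  · intro j _ hj
    simp [hj]
  · simp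

/-- The weights of `p_m` in the discrete integral `S⁽ⁱ⁾` of `discreteWronskian_intertwining`. -/
noncomputable def adjointWeight (w : Fin k → ℤ → ℝ) (r : ℤ → ℝ) (i : Fin k) (m : ℤ) : ℝ :=
  ∑ j : Fin k, r (m + j + 1) * (wronskianMatrix w (m + j)).adjugate j i

theorem sum_mul_adjointWeight {w : Fin k → ℤ → ℝ} {F r : ℤ → ℝ}
    (hF : ∀ n, F n - F (n - 1) = r n * discreteWronskian w (n - 1)) (n : ℤ) :
    ∑ i, w i n * adjointWeight w r i n = F (n + k) - F n := by
  simp only [adjointWeight, Finset.mul_sum]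
  rw [Finset.sum_comm]
  have h : ∀ j : Fin k, ∑ i, w i n * (r (n + j + 1) * (wronskianMatrix w (n + j)).adjugate j i) =
      F (n + ((j : ℕ) + 1 : ℕ)) - F (n + (j : ℕ)) := by
    intro j
    have h1 := sum_mul_adjugate_wronskianMatrix w (n + j) j j
    rw [if_pos rfl, add_sub_cancel_right] at h1
    have h2 := hF (n + j + 1)
    rw [add_sub_cancel_right, ← h1, Finset.mul_sum] at h2
    push_cast
    rw [← add_assoc, h2]
    exact Finset.sum_congr rfl fun i _ => by ring
  rw [Finset.sum_congr rfl fun j _ => h j,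
    Fin.sum_univ_eq_sum_range (fun j => F (n + (j + 1 : ℕ)) - F (n + (j : ℕ))) k,
    Finset.sum_range_sub (fun j => F (n + (j : ℕ)))]
  simp

/-- The discrete Darboux transformation. Let `F` be a sequence whose difference is divisible by
the Wronskian of `w`, and let `S⁽ⁱ⁾` be discrete integrals of `p` with the weights `adjointWeight`.
Then the Wronskian map `p ↦ Wr(w, p)` carries
`n ↦ F_{n+k} p_n - ∑ᵢ w⁽ⁱ⁾_n S⁽ⁱ⁾_n` to `F` times the Wronskian of `p`. -/
theorem discreteWronskian_intertwining (w : Fin k → ℤ → ℝ) (F r : ℤ → ℝ)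
    (hF : ∀ n, F n - F (n - 1) = r n * discreteWronskian w (n - 1)) (p : ℤ → V)
    (S : Fin k → ℤ → V) (hS : ∀ i n, S i n - S i (n - 1) = adjointWeight w r i n • p n) (n : ℤ) :
    ∑ j : Fin (k + 1), wronskianCoeff w n j •
      (F (n - (j : ℤ) + k) • p (n - (j : ℤ)) - ∑ i, w i (n - (j : ℤ)) • S i (n - (j : ℤ))) =
      F n • ∑ j : Fin (k + 1), wronskianCoeff w n j • p (n - (j : ℤ)) := by
  -- `K` collects those terms of the discrete integral that come from windows strictly before `n`
  set K : Fin k → ℤ → V := fun i n => S i n - ∑ j : Fin k, ∑ t ∈ Finset.range ((j : ℕ) + 1),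
    (r (n + t + 1) * (wronskianMatrix w (n + t)).adjugate j i) • p (n + t - j) with hK
  have hKstep : ∀ i n, K i n - K i (n - 1) = ∑ j : Fin k,
      (r n * (wronskianMatrix w (n - 1)).adjugate j i) • p (n - 1 - j) := by
    intro i n
    have htel : ∀ j : Fin k,
        ∑ t ∈ Finset.range ((j : ℕ) + 1),
          (r (n + t + 1) * (wronskianMatrix w (n + t)).adjugate j i) • p (n + t - j) -
        ∑ t ∈ Finset.range ((j : ℕ) + 1),
          (r (n - 1 + t + 1) * (wronskianMatrix w (n - 1 + t)).adjugate j i) • p (n - 1 + t - j) =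
        (r (n + j + 1) * (wronskianMatrix w (n + j)).adjugate j i) • p n -
        (r n * (wronskianMatrix w (n - 1)).adjugate j i) • p (n - 1 - j) := by
      intro j
      rw [Finset.sum_range_succ, Finset.sum_range_succ', add_sub_cancel_right]
      have : ∀ t : ℕ, n - 1 + ((t + 1 : ℕ) : ℤ) = n + t := fun t => by push_cast; ring
      simp only [this, Nat.cast_zero, add_zero, sub_add_cancel]
      abel
    have hsum := Finset.sum_congr (rfl : (Finset.univ : Finset (Fin k)) = _) fun j _ => htel j
    rw [Finset.sum_sub_distrib, Finset.sum_sub_distrib, ← Finset.sum_smul] at hsum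
    have hw : ∑ j : Fin k, r (n + j + 1) * (wronskianMatrix w (n + j)).adjugate j i =
      adjointWeight w r i n := rfl
    rw [hw, ← hS i n] at hsum
    simp only [hK]
    rw [sub_sub_sub_comm, hsum]
    abel
  have hstep : ∀ (n : ℤ) (j₀ : Fin k),
      F n • p (n - 1 - j₀) - ∑ i, w i (n - 1 - j₀) • K i n =
      F (n - 1) • p (n - 1 - j₀) - ∑ i, w i (n - 1 - j₀) • K i (n - 1) := by
    intro n j₀
    rw [sub_eq_sub_iff_sub_eq_sub, ← sub_smul, hF, ← Finset.sum_sub_distrib]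
    simp only [← smul_sub, hKstep]
    rw [sum_smul_sum_adjugate w (n - 1) j₀ (r n) (fun j => p (n - 1 - j))]
  have hdiag : ∀ (m : ℤ) (l : ℕ), l ≤ k → F (m + l) • p m - ∑ i, w i m • K i (m + l) =
      F m • p m - ∑ i, w i m • K i m := by
    intro m l
    induction l with
    | zero => simp
    | succ l ih =>
      intro hl
      rw [← ih (by omega)]
      have h := hstep (m + (l + 1 : ℕ)) ⟨l, hl⟩
      have e1 : m + ((l + 1 : ℕ) : ℤ) - 1 = m + l := by push_cast; ring
      simpa only [e1, add_sub_cancel_right] using h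
  have hX : ∀ m : ℤ, F m • p m - ∑ i, w i m • K i m =
      F (m + k) • p m - ∑ i, w i m • S i m := by
    intro m
    have h1 : ∀ j : Fin k, ∑ i, w i m • ∑ t ∈ Finset.range ((j : ℕ) + 1),
        (r (m + t + 1) * (wronskianMatrix w (m + t)).adjugate j i) • p (m + t - j) =
        (F (m + ((j : ℕ) + 1 : ℕ)) - F (m + (j : ℕ))) • p m := by
      intro j
      simp only [Finset.smul_sum, smul_smul]
      rw [Finset.sum_comm, Finset.sum_eq_single_of_mem (j : ℕ) (Finset.self_mem_range_succ _)]
      · rw [add_sub_cancel_right, ← Finset.sum_smul]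
        have h1 := sum_mul_adjugate_wronskianMatrix w (m + j) j j
        rw [if_pos rfl, add_sub_cancel_right] at h1
        have h2 := hF (m + j + 1)
        rw [add_sub_cancel_right, ← h1, Finset.mul_sum] at h2
        push_cast
        rw [← add_assoc, h2]
        congr 1
        exact Finset.sum_congr rfl fun i _ => by ring
      · intro t ht htj
        have htlt : t < k := by have := Finset.mem_range.mp ht; omega
        have h1 := sum_mul_adjugate_wronskianMatrix w (m + t) j ⟨t, htlt⟩
        rw [if_neg (fun h => htj (by rw [h])), add_sub_cancel_right] at h1
        rw [← Finset.sum_smul]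
        have h2 : ∑ i, w i m * (r (m + t + 1) * (wronskianMatrix w (m + t)).adjugate j i) =
            r (m + t + 1) * ∑ i, w i m * (wronskianMatrix w (m + t)).adjugate j i := by
          rw [Finset.mul_sum]
          exact Finset.sum_congr rfl fun i _ => by ring
        rw [h2, h1, mul_zero, zero_smul]
    simp only [hK, smul_sub, Finset.sum_sub_distrib]
    have h2 : ∑ i, w i m • ∑ j : Fin k, ∑ t ∈ Finset.range ((j : ℕ) + 1),
        (r (m + t + 1) * (wronskianMatrix w (m + t)).adjugate j i) • p (m + t - j) =
        (F (m + k) - F m) • p m := by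
      have : ∀ i, w i m • ∑ j : Fin k, ∑ t ∈ Finset.range ((j : ℕ) + 1),
          (r (m + t + 1) * (wronskianMatrix w (m + t)).adjugate j i) • p (m + t - j) =
          ∑ j : Fin k, w i m • ∑ t ∈ Finset.range ((j : ℕ) + 1),
          (r (m + t + 1) * (wronskianMatrix w (m + t)).adjugate j i) • p (m + t - j) :=
        fun i => Finset.smul_sum
      simp only [this]
      rw [Finset.sum_comm, Finset.sum_congr rfl fun j _ => h1 j, ← Finset.sum_smul,
        Fin.sum_univ_eq_sum_range (fun j => F (m + (j + 1 : ℕ)) - F (m + (j : ℕ))) k,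
        Finset.sum_range_sub (fun j => F (m + (j : ℕ)))]
      simp
    rw [h2]
    module
  have hrow : ∀ j : Fin (k + 1),
      F (n - (j : ℤ) + k) • p (n - (j : ℤ)) - ∑ i, w i (n - (j : ℤ)) • S i (n - (j : ℤ)) =
      F n • p (n - (j : ℤ)) - ∑ i, w i (n - (j : ℤ)) • K i n := by
    intro j
    rw [← hX, ← hdiag (n - (j : ℤ)) j (by omega)]
    simp only [sub_add_cancel]
  simp only [hrow, smul_sub, Finset.sum_sub_distrib, Finset.smul_sum, smul_smul]
  rw [Finset.sum_comm (s := Finset.univ (α := Fin (k + 1)))]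
  have hzero : ∀ i, ∑ j : Fin (k + 1), (wronskianCoeff w n j * w i (n - (j : ℤ))) • K i n = 0 := by
    intro i
    rw [← Finset.sum_smul, sum_wronskianCoeff_mul, zero_smul]
  rw [Finset.sum_eq_zero fun i _ => hzero i, sub_zero]
  exact Finset.sum_congr rfl fun j _ => by rw [mul_comm]

end Summation

/-! ### Polynomials in `n` and the reflection `n ↦ -ξ - n` -/

theorem lam_reflect (ξ y : ℝ) : lam ξ (-ξ - y) = lam ξ y := by simp only [lam]; ring

theorem eq_of_eval_natCast {p q : ℝ[X]} (h : ∀ n : ℕ, p.eval (n : ℝ) = q.eval (n : ℝ)) : p = q :=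
  Polynomial.eq_of_infinite_eval_eq p q <|
    (Set.infinite_range_of_injective (Nat.cast_injective (R := ℝ))).mono <| by
      rintro _ ⟨n, rfl⟩; exact h n

/-- The polynomial `λ_n^ξ` in the indeterminate `n`. -/
noncomputable def lamPoly (ξ : ℝ) : ℝ[X] := -X * (X + C ξ)

theorem eval_lamPoly (ξ y : ℝ) : (lamPoly ξ).eval y = lam ξ y := by simp [lamPoly, lam]

theorem exists_eval_sq_of_even (p : ℝ[X]) (h : ∀ x, p.eval (-x) = p.eval x) :
    ∃ q : ℝ[X], ∀ x, p.eval x = q.eval (x ^ 2) := by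
  have hp : p.comp (C (-1) * X) = p := Polynomial.funext fun x => by simp [h]
  have hodd : ∀ i, p.coeff (2 * i + 1) = 0 := by
    intro i
    have h1 := congrArg (fun q => q.coeff (2 * i + 1)) hp
    simp only [comp_C_mul_X_coeff] at h1
    have h2 : ((-1 : ℝ)) ^ (2 * i + 1) = -1 := by simp [pow_succ, pow_mul]
    rw [h2] at h1
    linarith
  refine ⟨∑ i ∈ Finset.range (p.natDegree + 1), C (p.coeff (2 * i)) * X ^ i, fun x => ?_⟩
  rw [eval_eq_sum_range' (n := 2 * (p.natDegree + 1)) (by omega), eval_finsetSum]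
  generalize p.natDegree + 1 = N
  induction N with
  | zero => simp
  | succ N ih =>
    rw [Finset.sum_range_succ, ← ih, show 2 * (N + 1) = 2 * N + 1 + 1 by ring,
      Finset.sum_range_succ, Finset.sum_range_succ, hodd]
    simp [pow_mul]

/-- A polynomial in `n` which is invariant under the reflection is a polynomial in `λ_n^ξ`. -/
theorem exists_eval_lam_of_invariant (ξ : ℝ) (p : ℝ[X])
    (h : ∀ y, p.eval (-ξ - y) = p.eval y) : ∃ q : ℝ[X], ∀ y, p.eval y = q.eval (lam ξ y) := by
  obtain ⟨q, hq⟩ := exists_eval_sq_of_even (p.comp (X - C (ξ / 2))) fun x => by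
    have := h (x - ξ / 2)
    simp only [eval_comp, eval_sub, eval_X, eval_C]
    rw [← this]
    congr 1
    ring
  refine ⟨q.comp (C (ξ ^ 2 / 4) - X), fun y => ?_⟩
  have := hq (y + ξ / 2)
  simp only [eval_comp, eval_sub, eval_X, eval_C, add_sub_cancel_right] at this
  rw [this]
  simp only [eval_comp, eval_sub, eval_X, eval_C, lam]
  congr 1
  ring

/-- A polynomial in `n` which changes its sign under the reflection is `n + ξ / 2` times
a polynomial in `λ_n^ξ`. -/
theorem exists_mul_eval_lam_of_antiinvariant (ξ : ℝ) (p : ℝ[X])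
    (h : ∀ y, p.eval (-ξ - y) = -p.eval y) :
    ∃ q : ℝ[X], ∀ y, p.eval y = (y + ξ / 2) * q.eval (lam ξ y) := by
  have h0 : p.IsRoot (-(ξ / 2)) := by
    have := h (-(ξ / 2))
    rw [show -ξ - -(ξ / 2) = -(ξ / 2) by ring] at this
    rw [IsRoot.def]
    linarith
  obtain ⟨s, hs⟩ := dvd_iff_isRoot.mpr h0
  have hev : ∀ y, p.eval y = (y + ξ / 2) * s.eval y := fun y => by rw [hs]; simp
  have hinv : s.comp (-C ξ - X) = s := by
    have : (X - C (-(ξ / 2))) * s.comp (-C ξ - X) = (X - C (-(ξ / 2))) * s := by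
      refine Polynomial.funext fun y => ?_
      have h1 := h y
      rw [hev, hev] at h1
      simp only [eval_mul, eval_comp, eval_sub, eval_neg, eval_C, eval_X]
      linear_combination -h1
    exact mul_left_cancel₀ (X_sub_C_ne_zero _) this
  obtain ⟨q, hq⟩ := exists_eval_lam_of_invariant ξ s fun y => by
    have := congrArg (eval y) hinv
    simpa using this
  exact ⟨q, fun y => by rw [hev, hq]⟩

section Adjugate

variable {k : ℕ}

theorem adjugate_submatrix_perm (M : Matrix (Fin k) (Fin k) ℝ) (σ : Equiv.Perm (Fin k))
    (i j : Fin k) :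
    (M.submatrix id σ).adjugate j i = ((Equiv.Perm.sign σ : ℤ) : ℝ) * M.adjugate (σ j) i := by
  rw [Matrix.adjugate_apply, Matrix.adjugate_apply, ← Matrix.det_permute']
  congr 1
  ext a b
  by_cases ha : a = i
  · subst ha
    simp [Pi.single_apply]
  · simp [Matrix.updateRow_ne ha]

/-- The matrix `(g_i(λ^ξ_{y-j}))` for a real index `y`. -/
noncomputable def lamMatrix (ξ : ℝ) (g : Fin k → ℝ[X]) (y : ℝ) : Matrix (Fin k) (Fin k) ℝ :=
  Matrix.of fun i j => (g i).eval (lam ξ (y - (j : ℕ)))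

theorem lamMatrix_reflect (ξ : ℝ) (g : Fin k → ℝ[X]) (y : ℝ) :
    lamMatrix ξ g (k - 1 - ξ - y) = (lamMatrix ξ g y).submatrix id Fin.revPerm := by
  ext i j
  simp only [lamMatrix, Matrix.of_apply, Matrix.submatrix_apply, id, Fin.revPerm_apply,
    Fin.val_rev]
  rw [← lam_reflect ξ (y - _), Nat.cast_sub (by omega)]
  congr 2
  push_cast
  ring

/-- `lamMatrix` as a matrix of polynomials in the index. -/
noncomputable def lamMatrixPoly (ξ : ℝ) (g : Fin k → ℝ[X]) : Matrix (Fin k) (Fin k) ℝ[X] :=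
  Matrix.of fun i j => (g i).comp ((lamPoly ξ).comp (X - C ((j : ℕ) : ℝ)))

theorem map_eval_lamMatrixPoly (ξ : ℝ) (g : Fin k → ℝ[X]) (y : ℝ) :
    (evalRingHom y).mapMatrix (lamMatrixPoly ξ g) = lamMatrix ξ g y := by
  ext i j
  simp [lamMatrixPoly, lamMatrix, eval_comp, eval_lamPoly]

/-- The weights `adjointWeight`, as polynomials in the index, change their sign under the
reflection: the windows that contain `n` are permuted, and the factor `r`, the minors and the
ordering of the columns contribute signs with product `-1`. -/
theorem exists_adjointWeight_poly (ξ : ℝ) (g : Fin k → ℝ[X]) (r : ℝ[X])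
    (hr : ∀ y, r.eval (k + 1 - ξ - y) =
      -((Equiv.Perm.sign (Fin.revPerm (n := k)) : ℤ) : ℝ) * r.eval y) (i : Fin k) :
    ∃ q : ℝ[X], ∀ y : ℝ, ∑ j : Fin k,
      r.eval (y + (j : ℕ) + 1) * (lamMatrix ξ g (y + (j : ℕ))).adjugate j i =
        (y + ξ / 2) * q.eval (lam ξ y) := by
  set R : ℝ[X] := ∑ j : Fin k, r.comp (X + C ((j : ℕ) : ℝ) + 1) *
    ((lamMatrixPoly ξ g).adjugate j i).comp (X + C ((j : ℕ) : ℝ)) with hR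
  have hev : ∀ y, R.eval y = ∑ j : Fin k,
      r.eval (y + (j : ℕ) + 1) * (lamMatrix ξ g (y + (j : ℕ))).adjugate j i := by
    intro y
    rw [hR, eval_finsetSum]
    refine Finset.sum_congr rfl fun j _ => ?_
    have h1 : ∀ z, ((lamMatrixPoly ξ g).adjugate j i).eval z =
        (lamMatrix ξ g z).adjugate j i := by
      intro z
      rw [← map_eval_lamMatrixPoly, ← RingHom.map_adjugate]
      rfl
    simp [eval_comp, h1]
  obtain ⟨q, hq⟩ := exists_mul_eval_lam_of_antiinvariant ξ R fun y => by
    rw [hev, hev, ← Finset.sum_neg_distrib, ← Equiv.sum_comp Fin.revPerm]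
    refine Finset.sum_congr rfl fun j _ => ?_
    have hj : (((Fin.revPerm j : Fin k) : ℕ) : ℝ) = k - 1 - (j : ℕ) := by
      rw [Fin.revPerm_apply, Fin.val_rev, Nat.cast_sub (by omega)]
      push_cast
      ring
    rw [hj, show -ξ - y + (k - 1 - (j : ℕ)) + 1 = k + 1 - ξ - (y + (j : ℕ) + 1) by ring,
      show -ξ - y + (k - 1 - (j : ℕ)) = k - 1 - ξ - (y + (j : ℕ)) by ring, hr,
      lamMatrix_reflect, adjugate_submatrix_perm]
    have hsq : ((Equiv.Perm.sign (Fin.revPerm (n := k)) : ℤ) : ℝ) *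
        ((Equiv.Perm.sign (Fin.revPerm (n := k)) : ℤ) : ℝ) = 1 := by
      rw [← Int.cast_mul, ← Units.val_mul, Int.units_mul_self]
      simp
    have hrev : Fin.revPerm (Fin.revPerm j) = j := by simp
    rw [hrev]
    linear_combination -(r.eval (y + (j : ℕ) + 1) *
      (lamMatrix ξ g (y + (j : ℕ))).adjugate j i) * hsq
  exact ⟨q, fun y => by rw [← hev, hq]⟩

end Adjugate

/-! ### The operators with the extended Jacobi polynomials as eigenfunctions -/

theorem aeval_apply_of_apply_eq_smul {V : Type*} [AddCommGroup V] [Module ℝ V]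
    {L : Module.End ℝ V} {c : ℝ} {v : V} (h : L v = c • v) (q : ℝ[X]) :
    aeval L q v = q.eval c • v := by
  induction q using Polynomial.induction_on' with
  | add p q hp hq => simp [hp, hq, add_smul]
  | monomial n a =>
    have hpow : ∀ n : ℕ, (L ^ n) v = c ^ n • v := by
      intro n
      induction n with
      | zero => simp
      | succ n ih => rw [pow_succ', Module.End.mul_apply, ih, map_smul, h, smul_smul, pow_succ]
    simp [aeval_monomial, hpow, smul_smul, mul_comm]

theorem opD1_mem_algD (α : ℝ) : opD1 ∈ algD α := Algebra.subset_adjoin (by simp)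

theorem jacobiOp_mem_algD (α ξ : ℝ) : jacobiOp α ξ ∈ algD α :=
  sub_mem (sub_mem (Algebra.subset_adjoin (by simp)) (pow_mem (opD1_mem_algD α) 2))
    (Subalgebra.smul_mem _ (opD1_mem_algD α) ξ)

theorem aeval_jacobiOp_mem_algD (α ξ : ℝ) (q : ℝ[X]) : aeval (jacobiOp α ξ) q ∈ algD α :=
  Algebra.adjoin_le (Set.singleton_subset_iff.mpr (jacobiOp_mem_algD α ξ))
    (aeval_mem_adjoin_singleton ℝ (jacobiOp α ξ))

/-- Every polynomial in the spectral algebra is the eigenvalue of an operator in `𝔇_α`.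
The discrete integrals in `discreteWronskian_intertwining` are elements of `𝔇_α` applied to the
Jacobi polynomials: their weights have the form `(n + ξ/2) q(λ_n)`, the factor `q(λ_n)` is
produced by the hypergeometric operator, and the discrete integral of `(n + ξ/2) (-1)^n p_n` is
`(𝒟₁ + n + ξ) (-1)^n p_n / 2` by the first order relation. -/
theorem exists_mem_algD_apply_extJacobi {α β : ℝ} (hα : -1 < α) (hβ : -1 < β) {k : ℕ}
    {ψ : Fin k → ℤ → ℝ} (hψ : ∀ j, IsAltPolynomial (α + β + 1) (ψ j))
    (hτ : ∀ n : ℤ, -1 ≤ n → tau ψ n ≠ 0) {f : ℝ[X]} (hf : f ∈ spectralAlgebra (α + β + 1) ψ) :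
    ∃ B ∈ algD α, ∀ n : ℤ, B (extJacobi α β ψ n) =
      f.eval (lam (α + β + 1) (n - k / 2)) • extJacobi α β ψ n := by
  set ξ := α + β + 1 with hξ
  choose g hg using hψ
  obtain ⟨r, hr⟩ := hf
  set w : Fin k → ℤ → ℝ := fun i l => (-1) ^ l * ψ i l with hw
  have hsign : ∀ l : ℤ, ((-1 : ℝ)) ^ l * (-1) ^ l = 1 := fun l => by
    rw [← mul_zpow]; simp
  have hwg : ∀ i l, w i l = (g i).eval (lam ξ l) := by
    intro i l
    simp only [hw, hg]
    rw [← mul_assoc, hsign, one_mul]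
  have hmat : ∀ N : ℤ, wronskianMatrix w N = lamMatrix ξ g N := by
    intro N
    ext i j
    simp [wronskianMatrix, lamMatrix, hwg]
  have htau : ∀ N : ℤ, tau ψ N = (lamMatrix ξ g N).det := fun N => by rw [← hmat]; rfl
  set F : ℤ → ℝ := fun n => f.eval (lam ξ (n - k / 2)) with hFdef
  have hF : ∀ n, F n - F (n - 1) = r.eval (n : ℝ) * discreteWronskian w (n - 1) := by
    intro n
    have h1 := hr n
    simp only [hFdef]
    rw [show discreteWronskian w (n - 1) = tau ψ (n - 1) from rfl, ← h1]
    push_cast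
    rw [show (n : ℝ) - 1 - k / 2 = n - k / 2 - 1 by ring]
  have hrpoly : ∀ y : ℝ, f.eval (lam ξ (y - k / 2)) - f.eval (lam ξ (y - k / 2 - 1)) =
      r.eval y * (lamMatrix ξ g (y - 1)).det := by
    have hev : ∀ y : ℝ, ((lamMatrixPoly ξ g).det).eval y = (lamMatrix ξ g y).det := by
      intro y
      rw [← map_eval_lamMatrixPoly, ← RingHom.map_det]
      rfl
    have hpoly : f.comp ((lamPoly ξ).comp (X - C ((k : ℝ) / 2))) -
        f.comp ((lamPoly ξ).comp (X - C ((k : ℝ) / 2) - 1)) =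
        r * (lamMatrixPoly ξ g).det.comp (X - 1) := by
      refine eq_of_eval_natCast fun n => ?_
      have h1 := hr n
      rw [htau] at h1
      simp only [eval_sub, eval_comp, eval_lamPoly, eval_X, eval_C, eval_one, eval_mul, hev]
      simpa using h1
    intro y
    have h1 := congrArg (eval y) hpoly
    simpa only [eval_sub, eval_comp, eval_lamPoly, eval_X, eval_C, eval_one, eval_mul, hev] using h1
  -- the quotient `r` inherits its parity from the left-hand side and from `τ`
  have hrodd : ∀ y, r.eval (k + 1 - ξ - y) =
      -((Equiv.Perm.sign (Fin.revPerm (n := k)) : ℤ) : ℝ) * r.eval y := by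
    set ε : ℝ := ((Equiv.Perm.sign (Fin.revPerm (n := k)) : ℤ) : ℝ) with hε
    have hsq : ε * ε = 1 := by
      rw [hε, ← Int.cast_mul, ← Units.val_mul, Int.units_mul_self]
      simp
    have hpoly : r.comp (C ((k : ℝ) + 1 - ξ) - X) = -C ε * r := by
      refine eq_of_eval_natCast fun n => ?_
      have h1 := hrpoly n
      have h2 := hrpoly (k + 1 - ξ - n)
      rw [show (k : ℝ) + 1 - ξ - n - 1 = k - 1 - ξ - (n - 1) by ring, lamMatrix_reflect,
        Matrix.det_permute', ← lam_reflect, ← lam_reflect ξ (_ - 1),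
        show -ξ - ((k : ℝ) + 1 - ξ - n - k / 2) = n - k / 2 - 1 by ring,
        show -ξ - ((k : ℝ) + 1 - ξ - n - k / 2 - 1) = n - k / 2 by ring] at h2
      have h3 : (lamMatrix ξ g ((n : ℝ) - 1)).det ≠ 0 := by
        have := hτ ((n : ℤ) - 1) (by omega)
        rw [htau] at this
        simpa using this
      have h4 : (r.eval ((k : ℝ) + 1 - ξ - n) * ε + r.eval (n : ℝ)) *
          (lamMatrix ξ g ((n : ℝ) - 1)).det = 0 := by
        linear_combination -h1 - h2
      have h5 := (mul_eq_zero.mp h4).resolve_right h3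
      simp only [eval_comp, eval_sub, eval_C, eval_X, eval_mul, eval_neg]
      linear_combination ε * h5 - r.eval ((k : ℝ) + 1 - ξ - n) * hsq
    intro y
    have := congrArg (eval y) hpoly
    simpa using this
  choose q hq using exists_adjointWeight_poly ξ g r hrodd
  have hweight : ∀ i (m : ℤ), adjointWeight w (fun n => r.eval (n : ℝ)) i m =
      (m + ξ / 2) * (q i).eval (lam ξ m) := by
    intro i m
    rw [← hq, adjointWeight]
    refine Finset.sum_congr rfl fun j _ => ?_
    rw [hmat]
    push_cast
    rfl
  obtain ⟨h, hh⟩ := exists_eval_lam_of_invariant ξ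
    (C (1 / 2) * (f.comp ((lamPoly ξ).comp (X + C ((k : ℝ) / 2))) +
      f.comp ((lamPoly ξ).comp (X - C ((k : ℝ) / 2))))) fun y => by
    simp only [eval_mul, eval_add, eval_sub, eval_comp, eval_lamPoly, eval_X, eval_C]
    rw [show -ξ - y + (k : ℝ) / 2 = -ξ - (y - k / 2) by ring,
      show -ξ - y - (k : ℝ) / 2 = -ξ - (y + k / 2) by ring, lam_reflect, lam_reflect, add_comm]
  have hhF : ∀ n : ℤ, h.eval (lam ξ n) = 1 / 2 * (F (n + k) + F n) := by
    intro n
    rw [← hh]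
    simp only [eval_mul, eval_add, eval_sub, eval_comp, eval_lamPoly, eval_X, eval_C, hFdef]
    push_cast
    ring_nf
  set p : ℤ → ℝ[X] := fun l => ((-1 : ℝ) ^ l) • jacobi α β l with hp
  set L := jacobiOp α ξ with hL
  have hLp : ∀ n, L (p n) = lam ξ n • p n := by
    intro n
    simp only [hp, map_smul, hL, hξ, jacobiOp_jacobi hα hβ]
    rw [smul_comm]
  have hpow : ∀ n : ℤ, (-1 : ℝ) ^ (n - 1) = -(-1) ^ n := fun n => by
    rw [zpow_sub_one₀ (by norm_num)]; norm_num
  have hD1 : ∀ n : ℤ, opD1 (p n) - opD1 (p (n - 1)) =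
      (n : ℝ) • p n + (n + ξ - 1 : ℝ) • p (n - 1) := by
    intro n
    have := congrArg (fun v => ((-1 : ℝ) ^ n) • v) (opD1_jacobi_add hα hβ n)
    simp only [map_add] at this
    simp only [hp, map_smul, hpow, hξ]
    linear_combination (norm := module) this
  set S : Fin k → ℤ → ℝ[X] := fun i n =>
    (1 / 2 : ℝ) • aeval L (q i) (opD1 (p n) + (n + ξ : ℝ) • p n) with hS
  have hSdiff : ∀ i n, S i n - S i (n - 1) =
      adjointWeight w (fun n => r.eval (n : ℝ)) i n • p n := by
    intro i n
    have h1 : (opD1 (p n) + (n + ξ : ℝ) • p n) -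
        (opD1 (p (n - 1)) + ((n - 1 : ℤ) + ξ : ℝ) • p (n - 1)) = (2 * n + ξ : ℝ) • p n := by
      have := hD1 n
      push_cast
      linear_combination (norm := module) this
    simp only [hS]
    rw [← smul_sub, ← map_sub, h1, map_smul, aeval_apply_of_apply_eq_smul (hLp n), hweight,
      smul_smul, smul_smul]
    congr 1
    ring
  set B : Module.End ℝ ℝ[X] := aeval L h - (1 / 2 : ℝ) • ∑ i : Fin k,
    aeval L (q i) * (opD1 + (ξ / 2) • 1) * aeval L (g i) with hB
  have hBmem : B ∈ algD α := by
    refine sub_mem (aeval_jacobiOp_mem_algD α ξ h) (Subalgebra.smul_mem _ (sum_mem fun i _ => ?_) _)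
    exact mul_mem (mul_mem (aeval_jacobiOp_mem_algD α ξ _)
      (add_mem (opD1_mem_algD α) (Subalgebra.smul_mem _ (one_mem _) _)))
      (aeval_jacobiOp_mem_algD α ξ _)
  have hBp : ∀ n, B (p n) = F (n + k) • p n - ∑ i, w i n • S i n := by
    intro n
    have h1 : ∀ i, w i n • S i n =
        (1 / 2 : ℝ) • (aeval L (q i) * (opD1 + (ξ / 2) • 1) * aeval L (g i)) (p n) +
        (1 / 2 * (w i n * adjointWeight w (fun n => r.eval (n : ℝ)) i n)) • p n := by
      intro i
      simp only [hS, Module.End.mul_apply, aeval_apply_of_apply_eq_smul (hLp n), map_smul,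
        LinearMap.add_apply, LinearMap.smul_apply, Module.End.one_apply, map_add, hweight, hwg]
      module
    have h2 := sum_mul_adjointWeight hF n
    simp only [h1, Finset.sum_add_distrib]
    rw [← Finset.sum_smul, ← Finset.mul_sum, h2, hB, LinearMap.sub_apply, LinearMap.smul_apply,
      LinearMap.sum_apply, aeval_apply_of_apply_eq_smul (hLp n), hhF, Finset.smul_sum]
    module
  refine ⟨B, hBmem, fun n => ?_⟩
  have hext : extJacobi α β ψ n = (∏ j : Fin (k + 1), ((-1 : ℝ)) ^ (n - (j : ℤ))) •
      ∑ j : Fin (k + 1), wronskianCoeff w n j • p (n - (j : ℤ)) := by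
    have h1 := discreteWronskian_mul (fun l => C (((-1 : ℝ)) ^ l)) (Fin.snoc
      (α := fun _ => ℤ → ℝ[X]) (fun j l => algebraMap ℝ ℝ[X] (w j l)) p) n
    rw [discreteWronskian_snoc, ← map_prod, ← smul_eq_C_mul] at h1
    rw [← h1, extJacobi]
    congr 1
    funext i l
    refine Fin.lastCases ?_ (fun i => ?_) i
    · simp only [Fin.snoc_last, hp]
      rw [← smul_eq_C_mul, smul_smul, hsign, one_smul]
    · simp only [Fin.snoc_castSucc, hw, algebraMap_eq]
      rw [← C_mul, ← mul_assoc, hsign, one_mul]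
  rw [hext, map_smul, map_sum, smul_comm,
    ← discreteWronskian_intertwining w F (fun n => r.eval (n : ℝ)) hF p S hSdiff n]
  congr 1
  refine Finset.sum_congr rfl fun j _ => ?_
  rw [map_smul, hBp]

/-! ### Homogenization in `1 - x_1` and the differential equation on the simplex -/

section Simplex

variable {d m : ℕ}

/-- The Euler operator `∑ x_j ∂_{x_j}`. -/
noncomputable def eulerOp (d : ℕ) : Module.End ℝ (MvPolynomial (Fin d) ℝ) :=
  ∑ j, mulOp (MvPolynomial.X j) * partialOp j

/-- The operator `∑ (x_j ∂_{x_j}² + (γ_j + 1) ∂_{x_j})`, which lowers degrees by one. -/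
noncomputable def lowerOp (γ : Fin (d + 1) → ℝ) : Module.End ℝ (MvPolynomial (Fin d) ℝ) :=
  ∑ j : Fin d, (mulOp (MvPolynomial.X j) * partialOp j ^ 2 + (γ j.castSucc + 1) • partialOp j)

/-- The operator `∑ (x_j ∂_{x_j}² + (γ_j + 1) ∂_{x_j}) - E (E + |γ| + d)`, where `E` is the Euler
operator: the second order operator with the Jacobi polynomials on the simplex as
eigenfunctions. -/
noncomputable def simplexOp (γ : Fin (d + 1) → ℝ) : Module.End ℝ (MvPolynomial (Fin d) ℝ) :=
  lowerOp γ - eulerOp d * (eulerOp d + ((∑ i, γ i) + d) • 1)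

theorem eulerOp_apply (p : MvPolynomial (Fin d) ℝ) :
    eulerOp d p = ∑ j, MvPolynomial.X j * MvPolynomial.pderiv j p := by
  simp [eulerOp, LinearMap.sum_apply]

theorem lowerOp_apply (γ : Fin (d + 1) → ℝ) (p : MvPolynomial (Fin d) ℝ) :
    lowerOp γ p = ∑ j : Fin d, (MvPolynomial.X j * MvPolynomial.pderiv j (MvPolynomial.pderiv j p) +
      (γ j.castSucc + 1) • MvPolynomial.pderiv j p) := by
  simp [lowerOp, LinearMap.sum_apply, pow_two]

theorem eulerOp_of_isHomogeneous {p : MvPolynomial (Fin d) ℝ} {n : ℕ} (hp : p.IsHomogeneous n) :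
    eulerOp d p = (n : ℝ) • p := by
  rw [eulerOp_apply, hp.sum_X_mul_pderiv, Nat.cast_smul_eq_nsmul]

theorem pderiv_comm (i j : Fin d) (p : MvPolynomial (Fin d) ℝ) :
    MvPolynomial.pderiv i (MvPolynomial.pderiv j p) =
      MvPolynomial.pderiv j (MvPolynomial.pderiv i p) := by
  have h : ⁅MvPolynomial.pderiv (R := ℝ) i, MvPolynomial.pderiv (R := ℝ) j⁆ = 0 := by
    refine MvPolynomial.derivation_ext fun l => ?_
    rw [Derivation.commutator_apply]
    simp [MvPolynomial.pderiv_X, Pi.single_apply, apply_ite]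
  have h1 := congrArg (fun D : Derivation ℝ (MvPolynomial (Fin d) ℝ) _ => D p) h
  simpa [Derivation.commutator_apply, sub_eq_zero] using h1

theorem pderiv_eulerOp (i : Fin d) (p : MvPolynomial (Fin d) ℝ) :
    MvPolynomial.pderiv i (eulerOp d p) =
      MvPolynomial.pderiv i p + eulerOp d (MvPolynomial.pderiv i p) := by
  rw [eulerOp_apply, eulerOp_apply, map_sum]
  simp only [MvPolynomial.pderiv_mul, Finset.sum_add_distrib]
  congr 1
  · rw [Finset.sum_eq_single i]
    · simp
    · intro j _ hj
      simp [MvPolynomial.pderiv_X_of_ne hj]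
    · simp
  · refine Finset.sum_congr rfl fun j _ => ?_
    congr 1
    exact pderiv_comm i j p

theorem pderiv_of_isHomogeneous_zero {p : MvPolynomial (Fin d) ℝ} (hp : p.IsHomogeneous 0)
    (j : Fin d) : MvPolynomial.pderiv j p = 0 := by
  rw [MvPolynomial.totalDegree_eq_zero_iff_eq_C.mp (Nat.le_zero.mp hp.totalDegree_le)]
  simp

theorem lowerOp_of_isHomogeneous_zero (γ : Fin (d + 1) → ℝ) {p : MvPolynomial (Fin d) ℝ}
    (hp : p.IsHomogeneous 0) : lowerOp γ p = 0 := by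
  simp [lowerOp_apply, pderiv_of_isHomogeneous_zero hp]

theorem isHomogeneous_lowerOp (γ : Fin (d + 1) → ℝ) {p : MvPolynomial (Fin d) ℝ} {n : ℕ}
    (hp : p.IsHomogeneous (n + 1)) : (lowerOp γ p).IsHomogeneous n := by
  rw [lowerOp_apply]
  refine MvPolynomial.IsHomogeneous.sum _ _ _ fun j _ => ?_
  have h1 : (MvPolynomial.pderiv j p).IsHomogeneous n := hp.pderiv
  refine MvPolynomial.IsHomogeneous.add ?_ ?_
  · cases n with
    | zero =>
      rw [pderiv_of_isHomogeneous_zero h1, mul_zero]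
      exact MvPolynomial.isHomogeneous_zero _ _ _
    | succ n =>
      have h2 : (MvPolynomial.pderiv j (MvPolynomial.pderiv j p)).IsHomogeneous n := h1.pderiv
      rw [add_comm]
      exact (MvPolynomial.isHomogeneous_X ℝ j).mul h2
  · rw [MvPolynomial.smul_eq_C_mul]
    exact h1.C_mul _

theorem hatD1_eq : hatD1 m = eulerOp (m + 1) - partialOp 0 := by
  refine LinearMap.ext fun p => ?_
  rw [LinearMap.sub_apply, eulerOp_apply, Fin.sum_univ_succ]
  simp [hatD1, LinearMap.sum_apply]
  ring

theorem hatD1_apply (p : MvPolynomial (Fin (m + 1)) ℝ) :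
    hatD1 m p = eulerOp (m + 1) p - MvPolynomial.pderiv 0 p := by
  rw [hatD1_eq]; rfl

theorem sum_add_natCast_eq (γ : Fin (m + 2) → ℝ) :
    (∑ i, γ i) + ((m + 1 : ℕ) : ℝ) = alphaOf γ + γ 0 + 1 := by
  rw [alphaOf, Fin.sum_univ_succ]; push_cast; ring

/-- The operator on the simplex belongs to the algebra generated by `D̂₁` and `D̂₂`, by the same
formula as the hypergeometric operator belongs to `𝔇_α`. -/
theorem hatD2_apply (γ : Fin (m + 2) → ℝ) (p : MvPolynomial (Fin (m + 1)) ℝ) :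
    hatD2 γ p = simplexOp γ p + hatD1 m (hatD1 m p) + (alphaOf γ + γ 0 + 1) • hatD1 m p := by
  have h1 : hatD2 γ p = (1 - MvPolynomial.X 0) * MvPolynomial.pderiv 0 (MvPolynomial.pderiv 0 p) +
      ∑ j : Fin m, MvPolynomial.X j.succ *
        MvPolynomial.pderiv j.succ (MvPolynomial.pderiv j.succ p) -
      (2 : ℝ) • ∑ j : Fin m, MvPolynomial.X j.succ *
        MvPolynomial.pderiv j.succ (MvPolynomial.pderiv 0 p) -
      ((∑ i : Fin (m + 1), γ i.succ) + (m + 1)) • MvPolynomial.pderiv 0 p +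
      ∑ j : Fin m, (γ j.succ.castSucc + 1) • MvPolynomial.pderiv j.succ p := by
    simp [hatD2, LinearMap.sum_apply, pow_two]
  have h2 : simplexOp γ p = lowerOp γ p - (eulerOp (m + 1) (eulerOp (m + 1) p) +
      (alphaOf γ + γ 0 + 1) • eulerOp (m + 1) p) := by
    rw [← sum_add_natCast_eq]
    simp [simplexOp]
  have h3 := eulerOp_apply (MvPolynomial.pderiv 0 p)
  have h4 := lowerOp_apply γ p
  rw [Fin.sum_univ_succ] at h3 h4
  rw [Finset.sum_add_distrib] at h4
  simp only [Fin.castSucc_zero] at h4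
  have h5 := pderiv_eulerOp 0 p
  rw [h1, h2]
  simp only [hatD1_apply, map_sub, h5, h3, h4, alphaOf, MvPolynomial.smul_eq_C_mul, map_add,
    map_one, map_ofNat]
  ring

/-! ### Restriction to the subspaces `ℝ[x_1] (1 - x_1)^s P(x' / (1 - x_1))` -/

/-- `coneLift` as a linear map. -/
noncomputable def coneLin (m s : ℕ) :
    MvPolynomial (Fin m) ℝ →ₗ[ℝ] MvPolynomial (Fin (m + 1)) ℝ :=
  (MvPolynomial.basisMonomials (Fin m) ℝ).constr ℝ fun e =>
    (1 - MvPolynomial.X 0) ^ (s - ∑ j, e j) * ∏ j, MvPolynomial.X j.succ ^ e j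

theorem coneLin_apply (s : ℕ) (p : MvPolynomial (Fin m) ℝ) : coneLin m s p = coneLift s p := by
  conv_lhs => rw [p.as_sum]
  rw [map_sum, coneLift]
  refine Finset.sum_congr rfl fun e _ => ?_
  have : MvPolynomial.monomial e (p.coeff e) =
      p.coeff e • MvPolynomial.basisMonomials (Fin m) ℝ e := by
    simp [MvPolynomial.smul_monomial]
  rw [this, map_smul, coneLin, Module.Basis.constr_basis, MvPolynomial.smul_eq_C_mul, mul_assoc]

theorem coneLin_of_isHomogeneous (s : ℕ) {n : ℕ} {p : MvPolynomial (Fin m) ℝ}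
    (hp : p.IsHomogeneous n) :
    coneLin m s p = (1 - MvPolynomial.X 0) ^ (s - n) * MvPolynomial.rename Fin.succ p := by
  rw [coneLin_apply, coneLift]
  conv_rhs => rw [p.as_sum]
  rw [map_sum, Finset.mul_sum]
  refine Finset.sum_congr rfl fun e he => ?_
  have hn : ∑ j, e j = n := by
    rw [hp.degree_eq_sum_deg_support he]
    exact (Finset.sum_subset (Finset.subset_univ _) (by simp)).symm
  rw [hn, MvPolynomial.rename_monomial, MvPolynomial.monomial_eq, Finsupp.prod_mapDomain_index
    (by simp) (by simp [pow_add]), Finsupp.prod_fintype _ _ (by simp)]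
  ring

theorem pderiv_zero_mul_rename (M : ℕ) (p : MvPolynomial (Fin m) ℝ) :
    MvPolynomial.pderiv 0 ((1 - MvPolynomial.X 0) ^ M * MvPolynomial.rename Fin.succ p) =
      -((M : MvPolynomial (Fin (m + 1)) ℝ) * (1 - MvPolynomial.X 0) ^ (M - 1) *
        MvPolynomial.rename Fin.succ p) := by
  have h : MvPolynomial.pderiv 0 (MvPolynomial.rename (Fin.succ (n := m)) p) = 0 := by
    refine MvPolynomial.pderiv_eq_zero_of_notMem_vars fun h => ?_
    classical
    obtain ⟨j, _, hj⟩ := Finset.mem_image.mp (MvPolynomial.vars_rename _ _ h)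
    exact Fin.succ_ne_zero j hj
  rw [MvPolynomial.pderiv_mul, h, MvPolynomial.pderiv_pow]
  simp

theorem pderiv_succ_mul_rename (M : ℕ) (j : Fin m) (p : MvPolynomial (Fin m) ℝ) :
    MvPolynomial.pderiv j.succ ((1 - MvPolynomial.X 0) ^ M * MvPolynomial.rename Fin.succ p) =
      (1 - MvPolynomial.X 0) ^ M * MvPolynomial.rename Fin.succ (MvPolynomial.pderiv j p) := by
  rw [MvPolynomial.pderiv_mul, MvPolynomial.pderiv_pow,
    MvPolynomial.pderiv_rename (Fin.succ_injective m)]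
  have : (0 : Fin (m + 1)) ≠ j.succ := (Fin.succ_ne_zero j).symm
  simp [MvPolynomial.pderiv_X_of_ne this]

theorem hatD1_mul_rename (M : ℕ) (p : MvPolynomial (Fin m) ℝ) :
    hatD1 m ((1 - MvPolynomial.X 0) ^ M * MvPolynomial.rename Fin.succ p) =
      (1 - MvPolynomial.X 0) ^ M * MvPolynomial.rename Fin.succ ((M : ℝ) • p + eulerOp m p) := by
  have h1 : ∀ q, hatD1 m q = (MvPolynomial.X 0 - 1) * MvPolynomial.pderiv 0 q +
      ∑ j : Fin m, MvPolynomial.X j.succ * MvPolynomial.pderiv j.succ q := by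
    intro q
    simp [hatD1, LinearMap.sum_apply]
  rw [h1, pderiv_zero_mul_rename, eulerOp_apply]
  simp only [pderiv_succ_mul_rename, map_add, map_sum, map_mul, MvPolynomial.rename_X,
    MvPolynomial.smul_eq_C_mul, MvPolynomial.rename_C, mul_add, Finset.mul_sum]
  congr 1
  · cases M with
    | zero => simp
    | succ M => simp [pow_succ]; ring
  · exact Finset.sum_congr rfl fun j _ => by ring

theorem mul_hatD2_mul_rename (γ : Fin (m + 2) → ℝ) (M : ℕ) {n : ℕ}
    {p : MvPolynomial (Fin m) ℝ} (hp : p.IsHomogeneous n) :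
    (1 - MvPolynomial.X 0) *
        hatD2 γ ((1 - MvPolynomial.X 0) ^ M * MvPolynomial.rename Fin.succ p) =
      (1 - MvPolynomial.X 0) ^ (M + 1) * MvPolynomial.rename Fin.succ (lowerOp (Fin.tail γ) p) +
        (M * (M + 2 * n + alphaOf γ) : ℝ) •
          ((1 - MvPolynomial.X 0) ^ M * MvPolynomial.rename Fin.succ p) := by
  have h1 : ∀ p, hatD2 γ p =
      (1 - MvPolynomial.X 0) * MvPolynomial.pderiv 0 (MvPolynomial.pderiv 0 p) +
      ∑ j : Fin m, (MvPolynomial.X j.succ *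
        MvPolynomial.pderiv j.succ (MvPolynomial.pderiv j.succ p) +
        (γ j.succ.castSucc + 1) • MvPolynomial.pderiv j.succ p) -
      (2 : ℝ) • ∑ j : Fin m, MvPolynomial.X j.succ *
        MvPolynomial.pderiv 0 (MvPolynomial.pderiv j.succ p) -
      (alphaOf γ + 1) • MvPolynomial.pderiv 0 p := by
    intro p
    simp only [pderiv_comm 0]
    simp [hatD2, LinearMap.sum_apply, pow_two, Finset.sum_add_distrib, alphaOf]
    module
  have hE := eulerOp_of_isHomogeneous hp
  rw [eulerOp_apply] at hE
  have hE' := congrArg (MvPolynomial.rename (Fin.succ (n := m))) hE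
  simp only [map_sum, map_mul, MvPolynomial.rename_X, MvPolynomial.smul_eq_C_mul,
    MvPolynomial.rename_C] at hE'
  rw [h1, lowerOp_apply]
  simp only [pderiv_succ_mul_rename, pderiv_zero_mul_rename]
  have h2 : MvPolynomial.pderiv 0 (-((M : MvPolynomial (Fin (m + 1)) ℝ) *
      (1 - MvPolynomial.X 0) ^ (M - 1) * MvPolynomial.rename Fin.succ p)) =
      (M : MvPolynomial (Fin (m + 1)) ℝ) * ((M - 1 : ℕ) : MvPolynomial (Fin (m + 1)) ℝ) *
        (1 - MvPolynomial.X 0) ^ (M - 1 - 1) * MvPolynomial.rename Fin.succ p := by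
    rw [mul_assoc, ← MvPolynomial.C_eq_coe_nat, ← mul_neg, MvPolynomial.pderiv_C_mul, map_neg,
      pderiv_zero_mul_rename]
    ring
  have h3 : ∑ j : Fin m, MvPolynomial.X j.succ * -((M : MvPolynomial (Fin (m + 1)) ℝ) *
      (1 - MvPolynomial.X 0) ^ (M - 1) *
        MvPolynomial.rename Fin.succ (MvPolynomial.pderiv j p)) =
      -((M : MvPolynomial (Fin (m + 1)) ℝ) * (1 - MvPolynomial.X 0) ^ (M - 1) *
        (MvPolynomial.C (n : ℝ) * MvPolynomial.rename Fin.succ p)) := by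
    rw [← hE', Finset.mul_sum, ← Finset.sum_neg_distrib]
    exact Finset.sum_congr rfl fun j _ => by ring
  have h4 : ∑ j : Fin m, (MvPolynomial.X j.succ * ((1 - MvPolynomial.X 0) ^ M *
        MvPolynomial.rename Fin.succ (MvPolynomial.pderiv j (MvPolynomial.pderiv j p))) +
        (γ j.succ.castSucc + 1) • ((1 - MvPolynomial.X 0) ^ M *
          MvPolynomial.rename Fin.succ (MvPolynomial.pderiv j p))) =
      (1 - MvPolynomial.X 0) ^ M * MvPolynomial.rename Fin.succ
        (∑ j : Fin m, (MvPolynomial.X j * MvPolynomial.pderiv j (MvPolynomial.pderiv j p) +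
          (Fin.tail γ j.castSucc + 1) • MvPolynomial.pderiv j p)) := by
    rw [map_sum, Finset.mul_sum]
    refine Finset.sum_congr rfl fun j _ => ?_
    simp only [map_add, map_mul, MvPolynomial.rename_X, MvPolynomial.smul_eq_C_mul,
      MvPolynomial.rename_C, Fin.tail, Fin.succ_castSucc]
    ring
  rw [h2, h3, h4]
  simp only [MvPolynomial.smul_eq_C_mul, map_add, map_mul, map_natCast, map_one, map_ofNat]
  rcases M with _ | _ | M
  · simp
  · simp
    ring
  · simp only [Nat.add_sub_cancel]
    push_cast
    ring

end Simplex

section Restriction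

variable {m : ℕ}

/-- Linear maps that agree on homogeneous polynomials of degree at most `s` agree on polynomials
of degree at most `s`. -/
theorem apply_eq_of_isHomogeneous {V : Type*} [AddCommGroup V] [Module ℝ V]
    {f g : MvPolynomial (Fin m) ℝ →ₗ[ℝ] V} {s : ℕ} {P : MvPolynomial (Fin m) ℝ}
    (hP : P.totalDegree ≤ s)
    (h : ∀ n ≤ s, ∀ q : MvPolynomial (Fin m) ℝ, q.IsHomogeneous n → f q = g q) : f P = g P := by
  rw [← MvPolynomial.sum_homogeneousComponent P, map_sum, map_sum]
  refine Finset.sum_congr rfl fun n hn => ?_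
  have := Finset.mem_range.mp hn
  exact h n (by omega) _ (MvPolynomial.homogeneousComponent_isHomogeneous n P)

theorem hatD1_mul_coneLift {s : ℕ} {P : MvPolynomial (Fin m) ℝ} (hP : P.totalDegree ≤ s)
    (j : ℕ) :
    hatD1 m ((1 - MvPolynomial.X 0) ^ j * coneLift s P) =
      (j + s : ℝ) • ((1 - MvPolynomial.X 0) ^ j * coneLift s P) := by
  rw [← coneLin_apply]
  refine apply_eq_of_isHomogeneous
    (f := hatD1 m ∘ₗ LinearMap.mulLeft ℝ ((1 - MvPolynomial.X 0) ^ j) ∘ₗ coneLin m s)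
    (g := (j + s : ℝ) • LinearMap.mulLeft ℝ ((1 - MvPolynomial.X 0) ^ j) ∘ₗ coneLin m s)
    hP fun n hn q hq => ?_
  simp only [LinearMap.comp_apply, LinearMap.smul_apply, LinearMap.mulLeft_apply,
    coneLin_of_isHomogeneous s hq]
  rw [← mul_assoc, ← pow_add, hatD1_mul_rename, eulerOp_of_isHomogeneous hq, ← add_smul, map_smul,
    mul_smul_comm]
  congr 1
  rw [Nat.cast_add, Nat.cast_sub hn]
  ring

theorem mul_hatD2_mul_coneLift (γ : Fin (m + 2) → ℝ) {s : ℕ} {P : MvPolynomial (Fin m) ℝ}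
    (hP : P.totalDegree ≤ s) (j : ℕ) :
    (1 - MvPolynomial.X 0) * hatD2 γ ((1 - MvPolynomial.X 0) ^ j * coneLift s P) =
      (1 - MvPolynomial.X 0) ^ j * coneLift s (simplexOp (Fin.tail γ) P) +
        ((j + s) * (j + s + alphaOf γ) : ℝ) •
          ((1 - MvPolynomial.X 0) ^ j * coneLift s P) := by
  rw [← coneLin_apply, ← coneLin_apply]
  refine apply_eq_of_isHomogeneous
    (f := LinearMap.mulLeft ℝ (1 - MvPolynomial.X 0) ∘ₗ hatD2 γ ∘ₗ
      LinearMap.mulLeft ℝ ((1 - MvPolynomial.X 0) ^ j) ∘ₗ coneLin m s)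
    (g := LinearMap.mulLeft ℝ ((1 - MvPolynomial.X 0) ^ j) ∘ₗ coneLin m s ∘ₗ
      simplexOp (Fin.tail γ) + ((j + s) * (j + s + alphaOf γ) : ℝ) •
        LinearMap.mulLeft ℝ ((1 - MvPolynomial.X 0) ^ j) ∘ₗ coneLin m s)
    hP fun n hn q hq => ?_
  have hα : (∑ i, Fin.tail γ i) + (m : ℝ) = alphaOf γ := rfl
  have hs : simplexOp (Fin.tail γ) q =
      lowerOp (Fin.tail γ) q - (n * (n + alphaOf γ) : ℝ) • q := by
    simp only [simplexOp, LinearMap.sub_apply, Module.End.mul_apply, LinearMap.add_apply,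
      LinearMap.smul_apply, Module.End.one_apply, map_add, map_smul,
      eulerOp_of_isHomogeneous hq, hα]
    module
  have hlow : (1 - MvPolynomial.X 0) ^ j * coneLin m s (lowerOp (Fin.tail γ) q) =
      (1 - MvPolynomial.X 0) ^ (j + (s - n) + 1) *
        MvPolynomial.rename Fin.succ (lowerOp (Fin.tail γ) q) := by
    cases n with
    | zero => simp [lowerOp_of_isHomogeneous_zero _ hq]
    | succ n =>
      rw [coneLin_of_isHomogeneous s (isHomogeneous_lowerOp _ hq), ← mul_assoc, ← pow_add]
      congr 2
      omega
  simp only [LinearMap.comp_apply, LinearMap.smul_apply, LinearMap.mulLeft_apply,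
    LinearMap.add_apply]
  rw [hs, map_sub, mul_sub, hlow, map_smul]
  simp only [coneLin_of_isHomogeneous s hq]
  rw [← mul_assoc, ← pow_add, mul_hatD2_mul_rename γ _ hq, Nat.cast_add, Nat.cast_sub hn,
    mul_smul_comm, ← mul_assoc, ← pow_add]
  module

theorem inFirst_one_sub_pow (j : ℕ) :
    inFirst (m := m) ((1 - X) ^ j) = (1 - MvPolynomial.X 0) ^ j := by
  simp [inFirst]

/-- Multiplication of a fixed polynomial by polynomials in `x_1`. -/
noncomputable def inFirstMul (H : MvPolynomial (Fin (m + 1)) ℝ) :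
    ℝ[X] →ₗ[ℝ] MvPolynomial (Fin (m + 1)) ℝ :=
  LinearMap.mulRight ℝ H ∘ₗ (Polynomial.aeval (MvPolynomial.X 0)).toLinearMap

theorem inFirstMul_apply (H : MvPolynomial (Fin (m + 1)) ℝ) (g : ℝ[X]) :
    inFirstMul H g = inFirst g * H := rfl

theorem hatD1_inFirst_mul {s : ℕ} {P : MvPolynomial (Fin m) ℝ} (hP : P.totalDegree ≤ s)
    (g : ℝ[X]) :
    hatD1 m (inFirst g * coneLift s P) = inFirst (opD1 g + (s : ℝ) • g) * coneLift s P := by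
  have key : hatD1 m ∘ₗ inFirstMul (coneLift s P) =
      inFirstMul (coneLift s P) ∘ₗ (opD1 + (s : ℝ) • LinearMap.id) := by
    refine linearMap_ext_one_sub fun j => ?_
    simp only [LinearMap.comp_apply, LinearMap.add_apply, LinearMap.smul_apply, LinearMap.id_apply,
      opD1_one_sub_pow, ← add_smul, map_smul]
    rw [inFirstMul_apply, inFirst_one_sub_pow, hatD1_mul_coneLift hP]
  exact LinearMap.congr_fun key g

theorem one_sub_X_ne_zero : (1 - MvPolynomial.X 0 : MvPolynomial (Fin (m + 1)) ℝ) ≠ 0 := by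
  intro h
  have := congrArg (MvPolynomial.eval 0) h
  simp at this

/-- On `ℝ[x_1] (1 - x_1)^s P(x' / (1 - x_1))` the operator `D̂₂` acts as `𝒟₂` with the parameter
`α + 2s`, if `P` is an eigenfunction on the simplex with the eigenvalue of degree `s`. -/
theorem hatD2_inFirst_mul (γ : Fin (m + 2) → ℝ) {s : ℕ} {P : MvPolynomial (Fin m) ℝ}
    (hP : P.totalDegree ≤ s) (hL : simplexOp (Fin.tail γ) P = lam (alphaOf γ) s • P) (g : ℝ[X]) :
    hatD2 γ (inFirst g * coneLift s P) =
      inFirst (opD2 (alphaOf γ + 2 * s) g) * coneLift s P := by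
  suffices key : hatD2 γ ∘ₗ inFirstMul (coneLift s P) =
      inFirstMul (coneLift s P) ∘ₗ opD2 (alphaOf γ + 2 * s) from LinearMap.congr_fun key g
  refine linearMap_ext_one_sub fun j => ?_
  simp only [LinearMap.comp_apply]
  rw [inFirstMul_apply, inFirst_one_sub_pow]
  refine mul_left_cancel₀ one_sub_X_ne_zero ?_
  rw [mul_hatD2_mul_coneLift γ hP, hL, ← coneLin_apply s (_ • P), map_smul, coneLin_apply]
  cases j with
  | zero =>
    have : opD2 (alphaOf γ + 2 * s) ((1 - X) ^ 0) = 0 := by simp [opD2_apply]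
    rw [this, map_zero, mul_zero, lam]
    simp only [pow_zero, one_mul, Nat.cast_zero]
    module
  | succ j =>
    rw [opD2_one_sub_pow, map_smul, inFirstMul_apply, inFirst_one_sub_pow, mul_smul_comm,
      mul_smul_comm, ← mul_assoc, ← pow_succ', lam]
    push_cast
    module

theorem jacobi_params_eq (γ : Fin (m + 2) → ℝ) (s : ℕ) :
    2 * (s : ℝ) + (∑ i : Fin (m + 1), γ i.succ) + m = alphaOf γ + 2 * s := by
  rw [alphaOf]; ring

theorem neg_one_lt_alphaOf {γ : Fin (m + 2) → ℝ} (hγ : ∀ j, -1 < γ j) : -1 < alphaOf γ := by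
  have h : ∑ _i : Fin (m + 1), (-1 : ℝ) < ∑ i : Fin (m + 1), γ i.succ :=
    Finset.sum_lt_sum_of_nonempty Finset.univ_nonempty fun i _ => hγ _
  rw [alphaOf]
  simp at h
  linarith

end Restriction

/-- The Jacobi polynomials on the simplex are eigenfunctions, with an eigenvalue that depends on
the total degree only. -/
theorem simplexOp_simplexJacobi : ∀ {d : ℕ} {γ : Fin (d + 1) → ℝ} (_ : ∀ j, -1 < γ j)
    (η : Fin d → ℕ), simplexOp γ (simplexJacobi γ η) =
      lam ((∑ i, γ i) + d) (∑ j, η j : ℕ) • simplexJacobi γ η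
  | 0, γ, _, η => by
    simp [simplexOp, lowerOp, eulerOp, lam]
  | m + 1, γ, hγ, η => by
    have ih := simplexOp_simplexJacobi (γ := Fin.tail γ) (fun j => hγ j.succ) (Fin.tail η)
    have hdeg := totalDegree_simplexJacobi_le (Fin.tail γ) (Fin.tail η)
    change _ ≤ ∑ j : Fin m, η j.succ at hdeg
    set s := ∑ j : Fin m, η j.succ with hs
    set P := simplexJacobi (Fin.tail γ) (Fin.tail η)
    have hL : simplexOp (Fin.tail γ) P = lam (alphaOf γ) s • P := ih
    have hα := neg_one_lt_alphaOf hγ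
    have hs0 : (0 : ℝ) ≤ s := by positivity
    have hJ := jacobiOp_jacobi (α := alphaOf γ + 2 * s) (β := γ 0) (by linarith) (hγ 0) (η 0)
    have hrec : simplexJacobi γ η =
        inFirst (jacobi (alphaOf γ + 2 * s) (γ 0) (η 0)) * coneLift s P := by
      rw [← jacobi_params_eq]; rfl
    have hop : simplexOp γ (simplexJacobi γ η) = hatD2 γ (simplexJacobi γ η) -
        hatD1 m (hatD1 m (simplexJacobi γ η)) -
        (alphaOf γ + γ 0 + 1) • hatD1 m (simplexJacobi γ η) := by
      rw [hatD2_apply]; abel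
    rw [hop, hrec, hatD1_inFirst_mul hdeg, hatD1_inFirst_mul hdeg, hatD2_inFirst_mul γ hdeg hL]
    rw [jacobiOp_apply, sub_eq_iff_eq_add, sub_eq_iff_eq_add] at hJ
    simp only [← inFirstMul_apply, hJ, ← map_smul, ← map_sub]
    congr 1
    rw [sum_add_natCast_eq, Fin.sum_univ_succ, ← hs]
    simp only [map_add, map_smul, lam]
    push_cast
    module

/-! ### The intertwining maps -/

section Intertwiner

/-- The linear map on `ℝ[t]` with prescribed values on the powers of `1 - t`. -/
noncomputable def oneSubConstr {V : Type*} [AddCommGroup V] [Module ℝ V] (v : ℕ → V) :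
    ℝ[X] →ₗ[ℝ] V :=
  (Polynomial.basisMonomials ℝ).constr ℝ v ∘ₗ (Polynomial.aeval (1 - X : ℝ[X])).toLinearMap

theorem oneSubConstr_one_sub_pow {V : Type*} [AddCommGroup V] [Module ℝ V] (v : ℕ → V) (j : ℕ) :
    oneSubConstr v ((1 - X) ^ j) = v j := by
  have : (X : ℝ[X]) ^ j = Polynomial.basisMonomials ℝ j := by simp [X_pow_eq_monomial]
  simp only [oneSubConstr, LinearMap.comp_apply, AlgHom.toLinearMap_apply, map_pow, map_sub,
    map_one, aeval_X, sub_sub_cancel]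
  rw [this, Module.Basis.constr_basis]

/-- The ratio of the norming factors of `(1 - t)^{j+s}` for the parameter `α` and of `(1 - t)^j`
for the parameter `α + 2s`. -/
noncomputable def shiftFactor (α : ℝ) (s j : ℕ) : ℝ :=
  (j + s).factorial * poch (α + 1) (j + s) / (j.factorial * poch (α + 2 * s + 1) j)

theorem shiftFactor_succ {α : ℝ} (hα : -1 < α) (s j : ℕ) :
    ((j + 1) * (j + 1 + (α + 2 * s))) * shiftFactor α s (j + 1) =
      ((j + s + 1) * (j + s + 1 + α)) * shiftFactor α s j := by
  have h1 := (poch_pos (show 0 < α + 2 * s + 1 by have : (0 : ℝ) ≤ s := by positivity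
                                                  linarith) j).ne'
  have h2 : α + 2 * s + 1 + j ≠ 0 := by
    have : (0 : ℝ) ≤ s := by positivity
    have : (0 : ℝ) ≤ j := by positivity
    linarith
  have h3 : (j.factorial : ℝ) ≠ 0 := by positivity
  have e : j + 1 + s = (j + s) + 1 := by ring
  simp only [shiftFactor, e, poch_succ, Nat.factorial_succ]
  push_cast
  field_simp
  ring

theorem shiftFactor_zero {α : ℝ} (hα : -1 < α) (j : ℕ) : shiftFactor α 0 j = 1 := by
  have h1 := (poch_pos (show 0 < α + 1 by linarith) j).ne'
  simp only [shiftFactor, add_zero, Nat.cast_zero, mul_zero]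
  field_simp

variable {m : ℕ}

/-- The map `(1 - t)^{j+s} ↦ κ_j (1 - x_1)^j H`, `(1 - t)^i ↦ 0` for `i < s`, where `κ_j` is
`shiftFactor`. For `H = (1 - x_1)^s P(x' / (1 - x_1))` with a Jacobi polynomial `P` of degree `s`
it intertwines `𝒟₁, 𝒟₂` with `D̂₁, D̂₂`. -/
noncomputable def intertwiner (α : ℝ) (s : ℕ) (H : MvPolynomial (Fin (m + 1)) ℝ) :
    ℝ[X] →ₗ[ℝ] MvPolynomial (Fin (m + 1)) ℝ :=
  oneSubConstr fun i => if i < s then 0 else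
    shiftFactor α s (i - s) • ((1 - MvPolynomial.X 0) ^ (i - s) * H)

theorem intertwiner_of_lt (α : ℝ) {s i : ℕ} (h : i < s) (H : MvPolynomial (Fin (m + 1)) ℝ) :
    intertwiner α s H ((1 - X) ^ i) = 0 := by
  rw [intertwiner, oneSubConstr_one_sub_pow, if_pos h]

theorem intertwiner_add (α : ℝ) (s j : ℕ) (H : MvPolynomial (Fin (m + 1)) ℝ) :
    intertwiner α s H ((1 - X) ^ (s + j)) =
      shiftFactor α s j • ((1 - MvPolynomial.X 0) ^ j * H) := by
  rw [intertwiner, oneSubConstr_one_sub_pow, if_neg (by omega), Nat.add_sub_cancel_left]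

theorem intertwiner_zero {α : ℝ} (hα : -1 < α) (H : MvPolynomial (Fin (m + 1)) ℝ) (g : ℝ[X]) :
    intertwiner α 0 H g = inFirst g * H := by
  refine LinearMap.congr_fun (g := inFirstMul H) (linearMap_ext_one_sub fun j => ?_) g
  have := intertwiner_add α 0 j H
  rw [zero_add] at this
  rw [this, shiftFactor_zero hα, one_smul, inFirstMul_apply, inFirst_one_sub_pow]

theorem hatD1_intertwiner (α : ℝ) {s : ℕ} {P : MvPolynomial (Fin m) ℝ} (hP : P.totalDegree ≤ s) :
    hatD1 m ∘ₗ intertwiner α s (coneLift s P) = intertwiner α s (coneLift s P) ∘ₗ opD1 := by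
  refine linearMap_ext_one_sub fun i => ?_
  simp only [LinearMap.comp_apply, opD1_one_sub_pow, map_smul]
  rcases lt_or_ge i s with h | h
  · rw [intertwiner_of_lt α h, map_zero, smul_zero]
  · obtain ⟨j, rfl⟩ := Nat.exists_eq_add_of_le h
    rw [intertwiner_add, map_smul, hatD1_mul_coneLift hP, smul_comm]
    push_cast
    rw [add_comm (j : ℝ)]

theorem hatD2_intertwiner (γ : Fin (m + 2) → ℝ) (hγ : ∀ j, -1 < γ j) {s : ℕ}
    {P : MvPolynomial (Fin m) ℝ} (hP : P.totalDegree ≤ s)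
    (hL : simplexOp (Fin.tail γ) P = lam (alphaOf γ) s • P) :
    hatD2 γ ∘ₗ intertwiner (alphaOf γ) s (coneLift s P) =
      intertwiner (alphaOf γ) s (coneLift s P) ∘ₗ opD2 (alphaOf γ) := by
  have h0 : ∀ α, opD2 α ((1 - X) ^ 0) = 0 := fun α => by simp [opD2_apply]
  refine linearMap_ext_one_sub fun i => ?_
  simp only [LinearMap.comp_apply]
  rcases lt_or_ge i s with h | h
  · rw [intertwiner_of_lt _ h, map_zero]
    cases i with
    | zero => rw [h0, map_zero]
    | succ i => rw [opD2_one_sub_pow, map_smul, intertwiner_of_lt _ (by omega), smul_zero]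
  · obtain ⟨j, rfl⟩ := Nat.exists_eq_add_of_le h
    rw [intertwiner_add, map_smul, ← inFirst_one_sub_pow, hatD2_inFirst_mul γ hP hL,
      ← inFirstMul_apply]
    cases j with
    | zero =>
      rw [h0, map_zero, smul_zero, add_zero]
      cases s with
      | zero => rw [h0, map_zero]
      | succ s =>
        rw [opD2_one_sub_pow, map_smul, intertwiner_of_lt _ (Nat.lt_succ_self s), smul_zero]
    | succ j =>
      rw [← add_assoc, opD2_one_sub_pow, opD2_one_sub_pow, map_smul, map_smul, intertwiner_add,
        inFirstMul_apply, inFirst_one_sub_pow, smul_smul, smul_smul]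
      congr 1
      have := shiftFactor_succ (neg_one_lt_alphaOf hγ) s j
      push_cast
      linear_combination this

/-- The constant by which the intertwining maps multiply Jacobi polynomials. -/
noncomputable def shiftConst (ξ : ℝ) (s : ℕ) : ℝ := (-1) ^ s * poch ξ (2 * s)

theorem jacobiCoeff_mul_shiftFactor {α : ℝ} (hα : -1 < α) (ξ : ℝ) (s n i : ℕ) (hi : i ≤ n) :
    jacobiCoeff α ξ (s + n) (s + i) * shiftFactor α s i =
      shiftConst ξ s * jacobiCoeff (α + 2 * s) (ξ + 2 * s) n i := by
  have hs : (0 : ℝ) ≤ s := by positivity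
  have h1 := (poch_pos (show 0 < α + 1 by linarith) (i + s)).ne'
  have h2 := (poch_pos (show 0 < α + 2 * s + 1 by linarith) i).ne'
  rw [jacobiCoeff_of_le (by omega), jacobiCoeff_of_le hi, shiftFactor, shiftConst,
    show s + n - (s + i) = n - i by omega, show s + n + (s + i) = 2 * s + (n + i) by ring,
    poch_add ξ, add_comm s i]
  push_cast
  have h3 : ((n - i).factorial : ℝ) ≠ 0 := by positivity
  field_simp
  ring

/-- The intertwining maps carry Jacobi polynomials to Jacobi polynomials with the parameter
`α + 2s`, up to a constant that does not depend on the degree. -/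
theorem intertwiner_jacobi {α β : ℝ} (hα : -1 < α) (hβ : -1 < β) (s : ℕ)
    (H : MvPolynomial (Fin (m + 1)) ℝ) (N : ℤ) :
    intertwiner α s H (jacobi α β N) =
      shiftConst (α + β + 1) s • (inFirst (jacobi (α + 2 * s) β (N - s)) * H) := by
  have hneg : ∀ a : ℝ, ∀ l : ℤ, l < 0 → jacobi a β l = 0 := by
    intro a l hl
    obtain ⟨b, rfl⟩ := Int.eq_negSucc_of_lt_zero hl
    rfl
  rcases lt_or_ge N 0 with h | h
  · rw [hneg _ _ h, hneg _ _ (by omega), map_zero, inFirst, map_zero, zero_mul, smul_zero]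
  obtain ⟨N, rfl⟩ := Int.eq_ofNat_of_zero_le h
  change intertwiner α s H (jacobiNat α β N) = _
  rw [jacobiNat_eq_sum hα hβ, map_sum]
  rcases lt_or_ge N s with h | h
  · rw [hneg _ _ (by omega), inFirst, map_zero, zero_mul, smul_zero]
    refine Finset.sum_eq_zero fun i hi => ?_
    have := Finset.mem_range.mp hi
    rw [map_smul, intertwiner_of_lt α (by omega), smul_zero]
  · obtain ⟨n, rfl⟩ := Nat.exists_eq_add_of_le h
    have hn : ((s + n : ℕ) : ℤ) - s = n := by push_cast; ring
    rw [hn]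
    change _ = shiftConst (α + β + 1) s • (inFirst (jacobiNat (α + 2 * s) β n) * H)
    have hs : (0 : ℝ) ≤ s := by positivity
    rw [jacobiNat_eq_sum (by linarith) hβ, ← inFirstMul_apply, map_sum, Finset.smul_sum, add_assoc,
      Finset.sum_range_add, Finset.sum_eq_zero, zero_add]
    · refine Finset.sum_congr rfl fun i hi => ?_
      have := Finset.mem_range.mp hi
      rw [map_smul, map_smul, intertwiner_add, inFirstMul_apply, inFirst_one_sub_pow, smul_smul,
        smul_smul, jacobiCoeff_mul_shiftFactor hα _ s n i (by omega),
        show α + 2 * s + β + 1 = α + β + 1 + 2 * s by ring]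
    · intro i hi
      rw [map_smul, intertwiner_of_lt α (Finset.mem_range.mp hi), smul_zero]

variable {k : ℕ}

theorem extJacobi_eq_sum (α β : ℝ) (ψ : Fin k → ℤ → ℝ) (n : ℤ) :
    extJacobi α β ψ n =
      ∑ j : Fin (k + 1), wronskianCoeff ψ n j • jacobi α β (n - (j : ℤ)) :=
  discreteWronskian_snoc ψ (jacobi α β) n

theorem extJacobiParam_eq_sum (α β : ℝ) (ψ : Fin k → ℤ → ℝ) (s : ℕ) (n : ℤ) :
    extJacobiParam α β ψ s n =
      ∑ j : Fin (k + 1), wronskianCoeff ψ (n + s) j • jacobi (α + 2 * s) β (n - (j : ℤ)) := by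
  have h : ∀ j, wronskianCoeff (fun i l => ψ i (l + s)) n j = wronskianCoeff ψ (n + s) j := by
    intro j
    simp only [wronskianCoeff, sub_add_eq_add_sub]
  simp only [← h]
  exact discreteWronskian_snoc (fun i l => ψ i (l + s)) (jacobi (α + 2 * s) β) n

theorem intertwiner_extJacobi {α β : ℝ} (hα : -1 < α) (hβ : -1 < β) (s : ℕ)
    (H : MvPolynomial (Fin (m + 1)) ℝ) (ψ : Fin k → ℤ → ℝ) (n : ℤ) :
    intertwiner α s H (extJacobi α β ψ (n + s)) =
      shiftConst (α + β + 1) s • (inFirst (extJacobiParam α β ψ s n) * H) := by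
  rw [extJacobi_eq_sum, extJacobiParam_eq_sum, ← inFirstMul_apply, map_sum, map_sum,
    Finset.smul_sum]
  refine Finset.sum_congr rfl fun j _ => ?_
  rw [map_smul, map_smul, intertwiner_jacobi hα hβ, inFirstMul_apply, smul_comm,
    show n + s - (j : ℤ) - s = n - j by ring]

end Intertwiner

/-! ### Bases of polynomials -/

section Basis

variable {m k : ℕ}

theorem linearIndependent_of_degree_eq {g : ℕ → ℝ[X]} (hg : ∀ n, (g n).degree = n) :
    LinearIndependent ℝ g :=
  (⟨g, hg⟩ : Polynomial.Sequence ℝ).linearIndependent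

/-- Linear independence passes to the products `g_n(x_1) (1 - x_1)^s P(x' / (1 - x_1))`: on the
slices with `x_1` fixed they are multiples of `P` in the variables `x' / (1 - x_1)`. -/
theorem linearIndependent_inFirst_mul_coneLift {P : (Fin m → ℕ) → MvPolynomial (Fin m) ℝ}
    (hP : LinearIndependent ℝ P) (hdeg : ∀ η, (P η).totalDegree ≤ ∑ j, η j)
    {g : (Fin m → ℕ) → ℕ → ℝ[X]} (hg : ∀ η n, (g η n).degree = n) :
    LinearIndependent ℝ fun η : Fin (m + 1) → ℕ =>
      inFirst (g (Fin.tail η) (η 0)) * coneLift (∑ j, Fin.tail η j) (P (Fin.tail η)) := by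
  refine (linearIndependent_equiv (Fin.consEquiv fun _ => ℕ)).mp ?_
  classical
  rw [linearIndependent_iff']
  intro S c hS
  replace hS : ∑ a ∈ S, c a •
      (inFirst (g a.2 a.1) * coneLift (∑ j, a.2 j) (P a.2)) = 0 := hS
  have hzero : ∀ η, ∑ n ∈ S.image Prod.fst, (if (n, η) ∈ S then c (n, η) else 0) • g η n = 0 := by
    intro η
    refine eq_zero_of_infinite_isRoot _
      ((Set.finite_singleton (1 : ℝ)).infinite_compl.mono fun x hx => ?_)
    have hx1 : x ≠ 1 := hx
    have hu : 1 - x ≠ 0 := sub_ne_zero.mpr hx1.symm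
    have hlin : ∑ η ∈ S.image Prod.snd, ((1 - x) ^ (∑ j, η j) *
        (∑ n ∈ S.image Prod.fst, (if (n, η) ∈ S then c (n, η) else 0) • g η n).eval x) • P η
        = 0 := by
      refine MvPolynomial.funext fun y => ?_
      have h1 := congrArg (MvPolynomial.eval (Fin.cons x fun j => (1 - x) * y j)) hS
      have hy : (fun j : Fin m => (Fin.cons x (fun j => (1 - x) * y j) : Fin (m + 1) → ℝ) j.succ /
          (1 - (Fin.cons x (fun j => (1 - x) * y j) : Fin (m + 1) → ℝ) 0)) = y := by
        funext j
        simp only [Fin.cons_succ, Fin.cons_zero]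
        field_simp
      simp only [map_sum, map_zero, Fin.cons_zero, map_mul, MvPolynomial.smul_eval,
        eval_inFirst] at h1
      have h2 : ∀ a : ℕ × (Fin m → ℕ), MvPolynomial.eval (Fin.cons x fun j => (1 - x) * y j)
          (coneLift (∑ j, a.2 j) (P a.2)) =
          (1 - x) ^ (∑ j, a.2 j) * MvPolynomial.eval y (P a.2) := by
        intro a
        rw [eval_coneLift (hdeg a.2) _ (by simpa using hx1), hy, Fin.cons_zero]
      simp only [h2] at h1
      simp only [map_sum, map_zero, MvPolynomial.smul_eval, eval_finsetSum, eval_smul,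
        smul_eq_mul, Finset.mul_sum, Finset.sum_mul]
      refine Eq.trans ?_ h1
      rw [Finset.sum_comm, ← Finset.sum_product', ← Finset.sum_subset (Finset.subset_product (s := S))]
      · refine Finset.sum_congr rfl fun a ha => ?_
        rw [if_pos ha]
        ring
      · intro a _ ha
        simp [ha]
    by_cases hη : η ∈ S.image Prod.snd
    · have := linearIndependent_iff'.mp hP _ _ hlin η hη
      exact (mul_eq_zero.mp this).resolve_left (pow_ne_zero _ hu)
    · have : ∑ n ∈ S.image Prod.fst, (if (n, η) ∈ S then c (n, η) else 0) • g η n = 0 := by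
        refine Finset.sum_eq_zero fun n _ => ?_
        rw [if_neg, zero_smul]
        exact fun h => hη (Finset.mem_image_of_mem Prod.snd h)
      exact (congrArg (eval x) this).trans eval_zero
  intro a ha
  have := linearIndependent_iff'.mp (linearIndependent_of_degree_eq (hg a.2)) _ _ (hzero a.2) a.1
    (Finset.mem_image_of_mem Prod.fst ha)
  simpa [ha] using this

/-- A linearly independent family indexed by multi-indices whose members have at most the degree
of their index spans all polynomials, by counting dimensions in each degree. -/
theorem span_eq_top_of_totalDegree_le {d : ℕ} {R : (Fin d → ℕ) → MvPolynomial (Fin d) ℝ}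
    (hR : LinearIndependent ℝ R) (hdeg : ∀ η, (R η).totalDegree ≤ ∑ j, η j) :
    Submodule.span ℝ (Set.range R) = ⊤ := by
  rw [eq_top_iff]
  intro p _
  set N := p.totalDegree with hN
  set W := MvPolynomial.restrictTotalDegree (Fin d) ℝ N with hW
  have hmem : ∀ q : MvPolynomial (Fin d) ℝ, q ∈ W ↔ q.totalDegree ≤ N :=
    fun q => MvPolynomial.mem_restrictTotalDegree (Fin d) N q
  let I := {e : Fin d →₀ ℕ // e ∈ {n : Fin d →₀ ℕ | (n.sum fun _ e => e) ≤ N}}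
  have hsum : ∀ e : Fin d →₀ ℕ, (e.sum fun _ e => e) = ∑ j, e j :=
    fun e => Finsupp.sum_fintype _ _ (fun _ => rfl)
  have hfin : Finite I := by
    have : Set.Finite {n : Fin d →₀ ℕ | (n.sum fun _ e => e) ≤ N} := by
      refine (Set.finite_Iic (Finsupp.equivFunOnFinite.symm fun _ => N : Fin d →₀ ℕ)).subset ?_
      intro e he j
      have he' : ∑ j, e j ≤ N := (hsum e) ▸ he
      exact (Finset.single_le_sum (fun _ _ => Nat.zero_le _) (Finset.mem_univ j)).trans he'
    exact this.to_subtype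
  have : Fintype I := Fintype.ofFinite I
  let b : Module.Basis I ℝ W := MvPolynomial.basisRestrictSupport ℝ _
  have hfd : FiniteDimensional ℝ W := Module.Finite.of_basis b
  let v : I → W := fun e => ⟨R e.1, (hmem _).mpr ((hdeg _).trans ((hsum e.1) ▸ e.2))⟩
  have hv : LinearIndependent ℝ v := by
    refine LinearIndependent.of_comp W.subtype ?_
    exact hR.comp (fun e : I => (e.1 : Fin d → ℕ))
      (fun a b h => Subtype.ext (DFunLike.coe_injective h))
  have hspan : Submodule.span ℝ (Set.range v) = ⊤ :=
    hv.span_eq_top_of_card_eq_finrank' (Module.finrank_eq_card_basis b).symm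
  have hp : (⟨p, (hmem p).mpr le_rfl⟩ : W) ∈ Submodule.span ℝ (Set.range v) := by
    rw [hspan]; trivial
  have hmap := Submodule.mem_map_of_mem (f := W.subtype) hp
  rw [Submodule.map_span] at hmap
  refine Submodule.span_mono ?_ hmap
  rintro _ ⟨_, ⟨e, rfl⟩, rfl⟩
  exact ⟨_, rfl⟩

/-- The nondegeneracy condition on the parameters is inherited by the face `x_1 = 0`. -/
theorem forall_sum_Ici_tail_ne_zero {d : ℕ} {γ : Fin (d + 2) → ℝ}
    (h : ∀ j : Fin (d + 1),
      (∑ i ∈ Finset.Ici j.castSucc, γ i) + (((d + 1 : ℕ) : ℝ) - ((j : ℕ) : ℝ)) ≠ 0) (j : Fin d) :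
    (∑ i ∈ Finset.Ici j.castSucc, Fin.tail γ i) + ((d : ℝ) - ((j : ℕ) : ℝ)) ≠ 0 := by
  have h := h j.succ
  rw [← Fin.succ_castSucc, Fin.sum_Ici_succ, Fin.val_succ] at h
  push_cast at h
  rw [add_sub_add_right_eq_sub] at h
  exact h

theorem alphaOf_add_ne_zero {γ : Fin (m + 2) → ℝ}
    (h : ∀ j : Fin (m + 1),
      (∑ i ∈ Finset.Ici j.castSucc, γ i) + (((m + 1 : ℕ) : ℝ) - ((j : ℕ) : ℝ)) ≠ 0) :
    alphaOf γ + γ 0 + 1 ≠ 0 := by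
  have h := h 0
  have hI : Finset.Ici (Fin.castSucc (0 : Fin (m + 1))) = Finset.univ := by
    ext i; simp
  rw [hI, Fin.val_zero, Nat.cast_zero, sub_zero, sum_add_natCast_eq] at h
  exact h

theorem linearIndependent_simplexJacobi : ∀ {d : ℕ} {γ : Fin (d + 1) → ℝ} (_ : ∀ j, -1 < γ j)
    (_ : ∀ j : Fin d, (∑ i ∈ Finset.Ici j.castSucc, γ i) + ((d : ℝ) - ((j : ℕ) : ℝ)) ≠ 0),
    LinearIndependent ℝ (simplexJacobi γ)
  | 0, γ, _, _ => by
    refine LinearIndependent.of_subsingleton (default : Fin 0 → ℕ) ?_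
    simp [simplexJacobi]
  | m + 1, γ, hγ, hγ' => by
    have ih : LinearIndependent ℝ (simplexJacobi (Fin.tail γ)) :=
      linearIndependent_simplexJacobi (fun j => hγ j.succ) (forall_sum_Ici_tail_ne_zero hγ')
    have h0 := alphaOf_add_ne_zero hγ'
    have hα := neg_one_lt_alphaOf hγ
    refine linearIndependent_inFirst_mul_coneLift ih
      (totalDegree_simplexJacobi_le (Fin.tail γ))
      (g := fun η n => jacobi (2 * (∑ j : Fin m, η j : ℕ) + (∑ i : Fin (m + 1), γ i.succ) + m)
        (γ 0) n) fun η n => ?_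
    rw [jacobi_params_eq]
    have hs : (0 : ℝ) ≤ (∑ j : Fin m, η j : ℕ) := by positivity
    refine degree_jacobi (by linarith) (hγ 0) ?_ n
    rcases Nat.eq_zero_or_pos (∑ j : Fin m, η j) with h | h
    · rw [h]
      simpa using h0
    · have h1 : (1 : ℝ) ≤ (∑ j : Fin m, η j : ℕ) := by exact_mod_cast h
      have := hγ 0
      intro h2
      linarith

theorem discreteWronskian_ne_zero_of_tau_ne_zero {ψ : Fin k → ℤ → ℝ} {n : ℤ}
    (h : tau ψ n ≠ 0) : discreteWronskian ψ n ≠ 0 := by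
  rw [tau, discreteWronskian_mul] at h
  exact right_ne_zero_of_mul h

theorem degree_extJacobiParam {α β : ℝ} (hα : -1 < α) (hβ : -1 < β) (h0 : α + β + 1 ≠ 0)
    {ψ : Fin k → ℤ → ℝ} (hτ : ∀ n : ℤ, -1 ≤ n → tau ψ n ≠ 0) (s n : ℕ) :
    (extJacobiParam α β ψ s n).degree = n := by
  have hs : (0 : ℝ) ≤ s := by positivity
  have hJ : (jacobi (α + 2 * s) β n).degree = n := by
    refine degree_jacobi (by linarith) hβ ?_ n
    rcases Nat.eq_zero_or_pos s with h | h
    · rw [h]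
      simpa using h0
    · have h1 : (1 : ℝ) ≤ s := by exact_mod_cast h
      intro h2
      linarith
  have hc : wronskianCoeff ψ (n + s) 0 ≠ 0 := by
    rw [wronskianCoeff_zero]
    exact mul_ne_zero (by simp) (discreteWronskian_ne_zero_of_tau_ne_zero (hτ _ (by omega)))
  rw [extJacobiParam_eq_sum, Fin.sum_univ_succ, Fin.val_zero, Nat.cast_zero, sub_zero,
    degree_add_eq_left_of_degree_lt]
  · rw [degree_smul_of_smul_regular _ (IsSMulRegular.of_ne_zero hc), hJ]
  · rw [degree_smul_of_smul_regular _ (IsSMulRegular.of_ne_zero hc), hJ]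
    rw [← mem_degreeLT]
    refine Submodule.sum_mem _ fun j _ => ?_
    rw [mem_degreeLT]
    refine lt_of_le_of_lt (degree_smul_le _ _) ?_
    rw [Fin.val_succ]
    rcases lt_or_ge (n : ℤ) ((j : ℕ) + 1 : ℕ) with h | h
    · obtain ⟨b, hb⟩ := Int.eq_negSucc_of_lt_zero (sub_neg.mpr h)
      rw [hb]
      change (0 : ℝ[X]).degree < _
      rw [degree_zero]
      exact WithBot.bot_lt_coe n
    · obtain ⟨l, hl⟩ := Int.eq_ofNat_of_zero_le (sub_nonneg.mpr h)
      rw [hl]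
      refine lt_of_le_of_lt (degree_le_of_natDegree_le (natDegree_jacobi_le _ _ l)) ?_
      have : l < n := by omega
      exact_mod_cast this

theorem extJacobiParam_zero (α β : ℝ) (ψ : Fin k → ℤ → ℝ) (n : ℤ) :
    extJacobiParam α β ψ 0 n = extJacobi α β ψ n := by
  simp [extJacobiParam, extJacobi]

/-- The extended Jacobi polynomials span `ℝ[t]`. -/
theorem linearMap_ext_extJacobi {V : Type*} [AddCommGroup V] [Module ℝ V] {α β : ℝ} (hα : -1 < α)
    (hβ : -1 < β) (h0 : α + β + 1 ≠ 0) {ψ : Fin k → ℤ → ℝ}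
    (hτ : ∀ n : ℤ, -1 ≤ n → tau ψ n ≠ 0) {A B : ℝ[X] →ₗ[ℝ] V}
    (h : ∀ n : ℕ, A (extJacobi α β ψ n) = B (extJacobi α β ψ n)) : A = B := by
  have hdeg : ∀ n : ℕ, (extJacobi α β ψ n).degree = n := fun n => by
    rw [← extJacobiParam_zero]; exact degree_extJacobiParam hα hβ h0 hτ 0 n
  let S : Polynomial.Sequence ℝ := ⟨fun n => extJacobi α β ψ n, hdeg⟩
  have hspan : Submodule.span ℝ (Set.range S) = ⊤ :=
    S.span fun n => (leadingCoeff_ne_zero.mpr (S.ne_zero n)).isUnit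
  refine LinearMap.ext_on_range hspan fun n => h n

end Basis

/-! ### Isomorphisms between algebras with two generators -/

/-- If all words in the pairs `(a₁, b₁)`, `(a₂, b₂)` have the property that one component vanishes
exactly if the other one does, then the graph of the correspondence is an isomorphism. -/
theorem exists_algEquiv_adjoin_pair {A B : Type*} [Ring A] [Ring B] [Algebra ℝ A] [Algebra ℝ B]
    (a₁ a₂ : A) (b₁ b₂ : B)
    (h : ∀ x ∈ Algebra.adjoin ℝ ({(a₁, b₁), (a₂, b₂)} : Set (A × B)), x.1 = 0 ↔ x.2 = 0) :
    ∃ Φ : Algebra.adjoin ℝ ({a₁, a₂} : Set A) ≃ₐ[ℝ] Algebra.adjoin ℝ ({b₁, b₂} : Set B),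
      ∀ x : Algebra.adjoin ℝ ({a₁, a₂} : Set A), ((x : A), (Φ x : B)) ∈ Algebra.adjoin ℝ ({(a₁, b₁), (a₂, b₂)} : Set (A × B)) := by
  set G := Algebra.adjoin ℝ ({(a₁, b₁), (a₂, b₂)} : Set (A × B)) with hG
  have h1 : G.map (AlgHom.fst ℝ A B) = Algebra.adjoin ℝ {a₁, a₂} := by
    rw [hG, AlgHom.map_adjoin, Set.image_pair]
    rfl
  have h2 : G.map (AlgHom.snd ℝ A B) = Algebra.adjoin ℝ {b₁, b₂} := by
    rw [hG, AlgHom.map_adjoin, Set.image_pair]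
    rfl
  let f₁ : G →ₐ[ℝ] Algebra.adjoin ℝ ({a₁, a₂} : Set A) :=
    ((AlgHom.fst ℝ A B).comp G.val).codRestrict _ fun x => h1 ▸ ⟨x, x.2, rfl⟩
  let f₂ : G →ₐ[ℝ] Algebra.adjoin ℝ ({b₁, b₂} : Set B) :=
    ((AlgHom.snd ℝ A B).comp G.val).codRestrict _ fun x => h2 ▸ ⟨x, x.2, rfl⟩
  have hb₁ : Function.Bijective f₁ := by
    constructor
    · rw [injective_iff_map_eq_zero]
      intro x hx
      have hx1 : (x : A × B).1 = 0 := congrArg Subtype.val hx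
      exact Subtype.ext (Prod.ext hx1 ((h x x.2).mp hx1))
    · rintro ⟨a, ha⟩
      rw [← h1] at ha
      obtain ⟨x, hx, rfl⟩ := ha
      exact ⟨⟨x, hx⟩, rfl⟩
  have hb₂ : Function.Bijective f₂ := by
    constructor
    · rw [injective_iff_map_eq_zero]
      intro x hx
      have hx2 : (x : A × B).2 = 0 := congrArg Subtype.val hx
      exact Subtype.ext (Prod.ext ((h x x.2).mpr hx2) hx2)
    · rintro ⟨b, hb⟩
      rw [← h2] at hb
      obtain ⟨x, hx, rfl⟩ := hb
      exact ⟨⟨x, hx⟩, rfl⟩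
  refine ⟨(AlgEquiv.ofBijective f₁ hb₁).symm.trans (AlgEquiv.ofBijective f₂ hb₂), fun x => ?_⟩
  obtain ⟨y, rfl⟩ := (AlgEquiv.ofBijective f₁ hb₁).surjective x
  simp only [AlgEquiv.trans_apply, AlgEquiv.symm_apply_apply]
  exact y.2

/-! ### The polynomials `Q_η` and the algebra isomorphism -/

theorem linearIndependent_polyQ {m k : ℕ} {γ : Fin (m + 2) → ℝ} (hγ : ∀ j, -1 < γ j)
    (hγ' : ∀ j : Fin (m + 1),
      (∑ i ∈ Finset.Ici j.castSucc, γ i) + (((m + 1 : ℕ) : ℝ) - ((j : ℕ) : ℝ)) ≠ 0)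
    {ψ : Fin k → ℤ → ℝ} (hτ : ∀ n : ℤ, -1 ≤ n → tau ψ n ≠ 0) :
    LinearIndependent ℝ (polyQ γ ψ) :=
  linearIndependent_inFirst_mul_coneLift
    (linearIndependent_simplexJacobi (fun j => hγ j.succ) (forall_sum_Ici_tail_ne_zero hγ'))
    (totalDegree_simplexJacobi_le (Fin.tail γ))
    (g := fun η n => extJacobiParam (alphaOf γ) (γ 0) ψ (∑ j, η j) n)
    fun _ n => degree_extJacobiParam (neg_one_lt_alphaOf hγ) (hγ 0)
      (alphaOf_add_ne_zero hγ') hτ _ n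

theorem totalDegree_polyQ_le {m k : ℕ} {γ : Fin (m + 2) → ℝ} (hγ : ∀ j, -1 < γ j)
    (h0 : alphaOf γ + γ 0 + 1 ≠ 0)
    {ψ : Fin k → ℤ → ℝ} (hτ : ∀ n : ℤ, -1 ≤ n → tau ψ n ≠ 0) (η : Fin (m + 1) → ℕ) :
    (polyQ γ ψ η).totalDegree ≤ ∑ j, η j := by
  rw [Fin.sum_univ_succ]
  refine (MvPolynomial.totalDegree_mul _ _).trans (add_le_add ?_ ?_)
  · refine (totalDegree_inFirst_le _).trans (natDegree_le_of_degree_le ?_)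
    exact (degree_extJacobiParam (neg_one_lt_alphaOf hγ) (hγ 0) h0 hτ _ _).le
  · exact totalDegree_coneLift_le (totalDegree_simplexJacobi_le (Fin.tail γ) (Fin.tail η))

theorem shiftConst_ne_zero {ξ : ℝ} (h : -1 < ξ) (h0 : ξ ≠ 0) (s : ℕ) : shiftConst ξ s ≠ 0 :=
  mul_ne_zero (by simp) (poch_ne_zero h h0 _)

/-- The intertwining map that carries the extended Jacobi polynomials `q_n` to multiples of the
polynomials `Q_η` whose last indices are `η'`. -/
noncomputable def simplexIntertwiner {m : ℕ} (γ : Fin (m + 2) → ℝ) (η' : Fin m → ℕ) :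
    ℝ[X] →ₗ[ℝ] MvPolynomial (Fin (m + 1)) ℝ :=
  intertwiner (alphaOf γ) (∑ j, η' j)
    (coneLift (∑ j, η' j) (simplexJacobi (Fin.tail γ) η'))

theorem simplexIntertwiner_extJacobi {m k : ℕ} {γ : Fin (m + 2) → ℝ} (hγ : ∀ j, -1 < γ j)
    (ψ : Fin k → ℤ → ℝ) (η : Fin (m + 1) → ℕ) :
    simplexIntertwiner γ (Fin.tail η) (extJacobi (alphaOf γ) (γ 0) ψ (∑ j, η j : ℕ)) =
      shiftConst (alphaOf γ + γ 0 + 1) (∑ j, Fin.tail η j) • polyQ γ ψ η := by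
  rw [simplexIntertwiner, Fin.sum_univ_succ (f := η), Nat.cast_add]
  exact intertwiner_extJacobi (neg_one_lt_alphaOf hγ) (hγ 0) _ _ ψ (η 0)

theorem comp_simplexIntertwiner_of_mem_adjoin {m : ℕ} {γ : Fin (m + 2) → ℝ} (hγ : ∀ j, -1 < γ j)
    (η' : Fin m → ℕ)
    {x : Module.End ℝ ℝ[X] × Module.End ℝ (MvPolynomial (Fin (m + 1)) ℝ)}
    (hx : x ∈ Algebra.adjoin ℝ ({(opD1, hatD1 m), (opD2 (alphaOf γ), hatD2 γ)} : Set _)) :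
    ∀ g, x.2 (simplexIntertwiner γ η' g) = simplexIntertwiner γ η' (x.1 g) := by
  have hdeg := totalDegree_simplexJacobi_le (Fin.tail γ) η'
  induction hx using Algebra.adjoin_induction with
  | mem x hx =>
    rcases hx with rfl | rfl
    · exact LinearMap.congr_fun (hatD1_intertwiner (alphaOf γ) hdeg)
    · exact LinearMap.congr_fun (hatD2_intertwiner γ hγ hdeg
        (simplexOp_simplexJacobi (fun j => hγ j.succ) η'))
  | algebraMap r =>
    intro g
    simp [Module.algebraMap_end_apply]
  | add x y _ _ hx hy =>
    intro g
    simp [hx, hy]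
  | mul x y _ _ hx hy =>
    intro g
    simp [hx, hy]

theorem span_polyQ_eq_top {m k : ℕ} {γ : Fin (m + 2) → ℝ} (hγ : ∀ j, -1 < γ j)
    (hγ' : ∀ j : Fin (m + 1),
      (∑ i ∈ Finset.Ici j.castSucc, γ i) + (((m + 1 : ℕ) : ℝ) - ((j : ℕ) : ℝ)) ≠ 0)
    {ψ : Fin k → ℤ → ℝ} (hτ : ∀ n : ℤ, -1 ≤ n → tau ψ n ≠ 0) :
    Submodule.span ℝ (Set.range (polyQ γ ψ)) = ⊤ :=
  span_eq_top_of_totalDegree_le (linearIndependent_polyQ hγ hγ' hτ)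
    (totalDegree_polyQ_le hγ (alphaOf_add_ne_zero hγ') hτ)

/-- Every `Q_η` is a multiple of the image of `q_{|η|}` under an intertwining map. Hence the images
of these maps span the polynomials in several variables. -/
theorem polyQ_eq_smul {m k : ℕ} {γ : Fin (m + 2) → ℝ} (hγ : ∀ j, -1 < γ j)
    (h0 : alphaOf γ + γ 0 + 1 ≠ 0) (ψ : Fin k → ℤ → ℝ) (η : Fin (m + 1) → ℕ) :
    polyQ γ ψ η = (shiftConst (alphaOf γ + γ 0 + 1) (∑ j, Fin.tail η j))⁻¹ •
      simplexIntertwiner γ (Fin.tail η) (extJacobi (alphaOf γ) (γ 0) ψ (∑ j, η j : ℕ)) := by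
  have hξ : -1 < alphaOf γ + γ 0 + 1 := by linarith [hγ 0, neg_one_lt_alphaOf hγ]
  rw [simplexIntertwiner_extJacobi hγ, smul_smul, inv_mul_cancel₀ (shiftConst_ne_zero hξ h0 _),
    one_smul]

section Isomorphism

variable {m : ℕ} {γ : Fin (m + 2) → ℝ}

/-- For the empty family of functions `ψ` the polynomials `Q_η` are the Jacobi polynomials on the
simplex and `τ` does not vanish. -/
theorem tau_elim0_ne_zero (n : ℤ) (_ : -1 ≤ n) : tau (Fin.elim0 : Fin 0 → ℤ → ℝ) n ≠ 0 := by
  simp [tau, discreteWronskian]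

theorem linearMap_ext_simplexIntertwiner (hγ : ∀ j, -1 < γ j)
    (hγ' : ∀ j : Fin (m + 1),
      (∑ i ∈ Finset.Ici j.castSucc, γ i) + (((m + 1 : ℕ) : ℝ) - ((j : ℕ) : ℝ)) ≠ 0)
    {A B : Module.End ℝ (MvPolynomial (Fin (m + 1)) ℝ)}
    (h : ∀ η' g, A (simplexIntertwiner γ η' g) = B (simplexIntertwiner γ η' g)) : A = B := by
  refine LinearMap.ext_on_range (span_polyQ_eq_top hγ hγ' tau_elim0_ne_zero) fun η => ?_
  rw [polyQ_eq_smul hγ (alphaOf_add_ne_zero hγ'), map_smul, map_smul, h]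

/-- For `η' = 0` the intertwining map is the multiplication of a nonzero polynomial by polynomials
in `x_1`. -/
theorem simplexIntertwiner_zero_injective (hγ : ∀ j, -1 < γ j)
    (hγ' : ∀ j : Fin (m + 1),
      (∑ i ∈ Finset.Ici j.castSucc, γ i) + (((m + 1 : ℕ) : ℝ) - ((j : ℕ) : ℝ)) ≠ 0) {g : ℝ[X]}
    (hg : simplexIntertwiner γ 0 g = 0) : g = 0 := by
  have hsum : ∑ j, (0 : Fin m → ℕ) j = 0 := by simp
  rw [simplexIntertwiner, hsum, intertwiner_zero (neg_one_lt_alphaOf hγ)] at hg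
  have hH : coneLift 0 (simplexJacobi (Fin.tail γ) 0) ≠ 0 := by
    intro hH
    refine (linearIndependent_polyQ hγ hγ' tau_elim0_ne_zero).ne_zero 0 ?_
    have ht : Fin.tail (0 : Fin (m + 1) → ℕ) = 0 := rfl
    simp [polyQ, ht, hH]
  have h1 := (mul_eq_zero.mp hg).resolve_right hH
  refine Polynomial.funext fun t => ?_
  have h2 := congrArg (MvPolynomial.eval fun _ => t) h1
  rw [eval_inFirst, map_zero] at h2
  simpa using h2

/-- The algebras `𝔇_α` and `𝔇̂_γ` are isomorphic, compatibly with all intertwining maps. -/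
theorem exists_algEquiv_simplexIntertwiner (hγ : ∀ j, -1 < γ j)
    (hγ' : ∀ j : Fin (m + 1),
      (∑ i ∈ Finset.Ici j.castSucc, γ i) + (((m + 1 : ℕ) : ℝ) - ((j : ℕ) : ℝ)) ≠ 0) :
    ∃ Φ : algD (alphaOf γ) ≃ₐ[ℝ] hatAlgD γ, ∀ x η' g,
      (Φ x : Module.End ℝ (MvPolynomial (Fin (m + 1)) ℝ)) (simplexIntertwiner γ η' g) =
        simplexIntertwiner γ η' ((x : Module.End ℝ ℝ[X]) g) := by
  obtain ⟨Φ, hΦ⟩ := exists_algEquiv_adjoin_pair opD1 (opD2 (alphaOf γ)) (hatD1 m) (hatD2 γ) <| by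
    intro x hx
    have hcomm := fun η' => comp_simplexIntertwiner_of_mem_adjoin hγ η' hx
    constructor
    · intro h1
      refine linearMap_ext_simplexIntertwiner hγ hγ' fun η' g => ?_
      rw [hcomm, h1]
      simp
    · intro h2
      refine LinearMap.ext fun g => simplexIntertwiner_zero_injective hγ hγ' ?_
      rw [← hcomm, h2, LinearMap.zero_apply]
  exact ⟨Φ, fun x η' => comp_simplexIntertwiner_of_mem_adjoin hγ η' (hΦ x)⟩

end Isomorphism

end AppellLauricella

open AppellLauricella in
theorem mainTheorem1 (m k : ℕ) (hk : 1 ≤ k) (γ : Fin (m + 2) → ℝ)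
    (hγ : ∀ j, -1 < γ j)
    (hγ' : ∀ j : Fin (m + 1),
      (∑ i ∈ Finset.Ici j.castSucc, γ i) + (((m + 1 : ℕ) : ℝ) - ((j : ℕ) : ℝ)) ≠ 0)
    (ψ : Fin k → ℤ → ℝ)
    (hψ : ∀ j, IsAltPolynomial (alphaOf γ + γ 0 + 1) (ψ j))
    (hτ : ∀ n : ℤ, -1 ≤ n → tau ψ n ≠ 0) :
    (LinearIndependent ℝ (polyQ γ ψ) ∧
      Submodule.span ℝ (Set.range (polyQ γ ψ)) = ⊤) ∧
    ∃ Φ : algD (alphaOf γ) ≃ₐ[ℝ] hatAlgD γ,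
      Φ (genD1 (alphaOf γ)) = hatGenD1 γ ∧ Φ (genD2 (alphaOf γ)) = hatGenD2 γ ∧
      ∀ f ∈ spectralAlgebra (alphaOf γ + γ 0 + 1) ψ,
        ∃ B : algD (alphaOf γ),
          (∀ n : ℕ, (B : Module.End ℝ (Polynomial ℝ)) (extJacobi (alphaOf γ) (γ 0) ψ n) =
            f.eval (lam (alphaOf γ + γ 0 + 1) (n - k / 2)) • extJacobi (alphaOf γ) (γ 0) ψ n) ∧
          (∀ B' : algD (alphaOf γ),
            (∀ n : ℕ, (B' : Module.End ℝ (Polynomial ℝ)) (extJacobi (alphaOf γ) (γ 0) ψ n) =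
              f.eval (lam (alphaOf γ + γ 0 + 1) (n - k / 2)) •
                extJacobi (alphaOf γ) (γ 0) ψ n) → B' = B) ∧
          ∀ η : Fin (m + 1) → ℕ,
            (Φ B : Module.End ℝ (MvPolynomial (Fin (m + 1)) ℝ)) (polyQ γ ψ η) =
              f.eval (lam ((∑ i, γ i) + ((m + 1 : ℕ) : ℝ)) (((∑ i, η i : ℕ) : ℝ) - k / 2)) •
                polyQ γ ψ η := by
  have hα := neg_one_lt_alphaOf hγ
  have h0 := alphaOf_add_ne_zero hγ'
  obtain ⟨Φ, hΦ⟩ := exists_algEquiv_simplexIntertwiner hγ hγ'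
  refine ⟨⟨linearIndependent_polyQ hγ hγ' hτ, span_polyQ_eq_top hγ hγ' hτ⟩, Φ, ?_, ?_,
    fun f hf => ?_⟩
  · refine Subtype.ext (linearMap_ext_simplexIntertwiner hγ hγ' fun η' g => ?_)
    rw [hΦ]
    exact (comp_simplexIntertwiner_of_mem_adjoin hγ η'
      (Algebra.subset_adjoin (Set.mem_insert (opD1, hatD1 m) _)) g).symm
  · refine Subtype.ext (linearMap_ext_simplexIntertwiner hγ hγ' fun η' g => ?_)
    rw [hΦ]
    exact (comp_simplexIntertwiner_of_mem_adjoin hγ η' (Algebra.subset_adjoin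
      (Set.mem_insert_of_mem (opD1, hatD1 m)
        (Set.mem_singleton (opD2 (alphaOf γ), hatD2 γ)))) g).symm
  · obtain ⟨B, hBmem, hB⟩ := exists_mem_algD_apply_extJacobi hα (hγ 0) hψ hτ hf
    refine ⟨⟨B, hBmem⟩, fun n => by simpa using hB n, fun B' hB' => ?_, fun η => ?_⟩
    · refine Subtype.ext (linearMap_ext_extJacobi hα (hγ 0) h0 hτ fun n => ?_)
      rw [hB' n]
      simpa using (hB n).symm
    · rw [sum_add_natCast_eq, polyQ_eq_smul hγ h0, map_smul, hΦ, hB, map_smul, smul_comm,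
        Int.cast_natCast]
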